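/- Let $d\ge 0$, let $\mu$ be a probability measure on $\mathbb{Z}^d$, let $\mathcal C\subset\mathbb{R}^d$ be a non-empty open convex cone with vertex at the origin, and let $E=\overline{\mathcal C}\cap\mathbb{Z}^d$. Let $(X(t))$ be the substochastic Markov chain on $E$ with transition probabilities $p(x,y)=\mu(y-x)$, $x,y\in E$ (the random walk with jump law $\mu$ killed on leaving $E$). It is considered on $E\cup\{\vartheta\}$, where $\vartheta$ is an absorbing state and $p(x,\vartheta)=1-\sum_{y\in E}p(x,y)$. Write $\mathbb{P}_x,\mathbb{E}_x$ for its law started at $x$, $\tau_\vartheta=\inf\{t\ge 1: X(t)=\vartheta\}$, $G(x,y)=\sum_{t\ge 0}\mathbb{P}_x(X(t)=y)$. Functions $\varphi$ on $E$ are extended by $\varphi(\vartheta)=0$. For $u\in E$ let $\eta_u=\inf\{t\ge 1: X(t)\notin E+u\}$; let $t_0=0$ and $t_{k+1}=\inf\{n>t_k: X(n)\notin E+X(t_k)\}$ if $t_k<\infty$ (with $E+\vartheta=\emptyset$), $t_{k+1}=\infty$ otherwise. The ladder height process $(H_n)$ is the substochastic Markov chain on $E$ with transition matrix $$p_H(x,y)=\sum_{z\in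 E}G(0,z)\,a_x(z,y),\qquad a_u(z,y)=\begin{cases}p(z+u,y)-p(z,y-u)&\text{if } y\in E+u,\\ p(z+u,y)&\text{otherwise,}\end{cases}$$ considered on $E\cup\{\vartheta\}$ with $p_H(x,\vartheta)=1-\sum_{y\in E} p_H(x,y)$ and $\vartheta$ absorbing. With $\mathcal T_\vartheta=\inf\{n\ge1: H_n=\vartheta\}$, its renewal function is $V(x)=\mathbb{E}_x(\mathcal T_\vartheta)$, $x\in E$. A function $\varphi:E\to[0,\infty)$ is harmonic (super harmonic) for a substochastic matrix $q$ on $E$ if $\sum_{y}q(x,y)\varphi(y)=\varphi(x)$ (respectively $\le\varphi(x)$) for all $x\in E$. Assume: (C0') $(X(t))$ is transient on $E$ (that is, $G(x,x)<\infty$ for every $x\in E$), and there are $\kappa>0$ and a finite set $\mathcal E_0\subset\mathbb{Z}^d$ with $\mu(e)>0$ for all $e\in\mathcal E_0$ such that for all $x\ne y$ in $E$ there is a sequence $x_0=x,x_1,\dots,x_n=y$ in $E$ with $n\le\kappa|y-x|$ and $x_j-x_{j-1}\in\mathcal E_0$ for $1\le j\le n$; (C2) the jump generating function $R(\alpha)=\sum_{x\in\mathbb{Z}^d}\mu(x)e^{\langle\alpha,x\rangle}\in(0,\infty]$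 satisfies $R(\alpha)>R(0)=1$ for all $\alpha\in\mathbb{R}^d\setminus\{0\}$. Let $h:E\to[0,\infty)$ be harmonic for $(X(t))$ and not identically zero. Then: 1. $h$ is super harmonic for $(H_n)$, and for all $x,u\in E$, $$h(x+u)=h(x)+\mathbb{E}_{x+u}\bigl(h(X(\eta_u));\ \eta_u<\infty\bigr).$$ 2. $V$ is finite on $E$, the limit $$\tilde h(x)=\lim_{n\to\infty}\mathbb{E}_x\bigl(h(X(t_n));\ t_n<\infty\bigr)\in[0,\infty)$$ exists for every $x\in E$, the function $\tilde h$ is harmonic for $(H_n)$, and $h=h(0)V+\tilde h$. 3. If $\mathbb{E}_z(\tau_\vartheta)=+\infty$ for some $z\in E$, then $\tilde h=0$ and $h$ is proportional to $V$. If $\mathbb{E}_z(\tau_\vartheta)<+\infty$ for some $z\in E$, then $\tilde h$ is not identically zero. -/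

import Mathlib

open MeasureTheory ProbabilityTheory Filter Topology
open scoped ENNReal NNReal

noncomputable section

/-! ### Substochastic Markov chains with an absorbing cemetery state

For a countable set `S`, the state space is `Option S`; the cemetery `ϑ` is `none`. -/

namespace SubMarkov

/-- The discrete σ-algebra on `S ∪ {ϑ}`. -/
instance optionMeasurableSpace {S : Type} : MeasurableSpace (Option S) := ⊤

instance optionDiscrete {S : Type} : DiscreteMeasurableSpace (Option S) := ⟨fun _ => trivial⟩

/-- `p` is a substochastic matrix on `S`. -/
def IsSubstochastic {S : Type} (p : S → S → ℝ≥0∞) : Prop := ∀ x, ∑' y, p x y ≤ 1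

/-- The transition probabilities on `S ∪ {ϑ}`: `p(x, ϑ) = 1 - ∑ y, p(x, y)`, and `ϑ` is absorbing. -/
def stepMass {S : Type} (p : S → S → ℝ≥0∞) : Option S → Option S → ℝ≥0∞
  | some x, some y => p x y
  | some x, none => 1 - ∑' y, p x y
  | none, none => 1
  | none, some _ => 0

theorem tsum_option' {S : Type} (f : Option S → ℝ≥0∞) :
    ∑' a, f a = f none + ∑' y, f (some y) := by
  rw [← (Equiv.optionEquivSumPUnit.{0, 0} S).symm.tsum_eq,
    Summable.tsum_sum ENNReal.summable ENNReal.summable, add_comm]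
  simp

theorem stepMass_tsum {S : Type} {p : S → S → ℝ≥0∞} (hp : IsSubstochastic p) (a : Option S) :
    ∑' b, stepMass p a b = 1 := by
  rw [tsum_option']
  cases a with
  | none => simp [stepMass]
  | some x => exact tsub_add_cancel_of_le (hp x)

/-- The transition law from a given state of `S ∪ {ϑ}`. -/
def stepPMF {S : Type} (p : S → S → ℝ≥0∞) (hp : IsSubstochastic p) (a : Option S) :
    PMF (Option S) :=
  ⟨stepMass p a, stepMass_tsum hp a ▸ ENNReal.summable.hasSum⟩

/-- The transition kernel on `S ∪ {ϑ}`. -/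
def stepKernel {S : Type} (p : S → S → ℝ≥0∞) (hp : IsSubstochastic p) :
    Kernel (Option S) (Option S) where
  toFun a := (stepPMF p hp a).toMeasure
  measurable' := Measurable.of_discrete

instance {S : Type} (p : S → S → ℝ≥0∞) (hp : IsSubstochastic p) :
    IsMarkovKernel (stepKernel p hp) :=
  ⟨fun a => by change IsProbabilityMeasure (stepPMF p hp a).toMeasure; infer_instance⟩

/-- The transition from time `n` to time `n + 1`, as a function of the past: only the present state
is used. -/
def pathKernel {S : Type} (p : S → S → ℝ≥0∞) (hp : IsSubstochastic p) (n : ℕ) :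
    Kernel (Π _ : Finset.Iic n, Option S) (Option S) :=
  (stepKernel p hp).comap (fun w => w ⟨n, Finset.mem_Iic.2 le_rfl⟩) (measurable_pi_apply _)

instance {S : Type} (p : S → S → ℝ≥0∞) (hp : IsSubstochastic p) (n : ℕ) :
    IsMarkovKernel (pathKernel p hp n) := by
  unfold pathKernel; infer_instance

/-- `ℙ_x`: the law, on the space of trajectories, of the Markov chain on `S ∪ {ϑ}` with transition
matrix `p` started at `x`. -/
def law {S : Type} (p : S → S → ℝ≥0∞) (hp : IsSubstochastic p) (x : S) : Measure (ℕ → Option S) :=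
  Kernel.traj (X := fun _ => Option S) (pathKernel p hp) 0 (fun _ => some x)

/-- The Green function `G(x, y) = ∑ t, ℙ_x(X(t) = y)`. -/
def green {S : Type} (p : S → S → ℝ≥0∞) (hp : IsSubstochastic p) (x y : S) : ℝ≥0∞ :=
  ∑' t : ℕ, law p hp x {ω | ω t = some y}

/-- Every state is transient: the expected number of visits is finite. -/
def IsTransient {S : Type} (p : S → S → ℝ≥0∞) (hp : IsSubstochastic p) : Prop :=
  ∀ x, green p hp x x ≠ ⊤

/-- The first time `t ≥ 1` at which the trajectory is at `ϑ` (`⊤` if there is none). -/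
def killingTime {S : Type} (ω : ℕ → Option S) : ℕ∞ :=
  ⨅ (t : ℕ) (_ : 1 ≤ t ∧ ω t = none), (t : ℕ∞)

/-- The expected killing time under `ℙ_x`. -/
def meanKillingTime {S : Type} (p : S → S → ℝ≥0∞) (hp : IsSubstochastic p) (x : S) : ℝ≥0∞ :=
  ∫⁻ ω, (killingTime ω : ℝ≥0∞) ∂(law p hp x)

/-- `φ(ω(T))` on `{T < ∞}` and `0` on `{T = ∞}`, where `φ` is extended by `φ(ϑ) = 0`. -/
def valueAt {S : Type} (φ : S → ℝ≥0) (ω : ℕ → Option S) (T : ℕ∞) : ℝ≥0∞ :=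
  if T = ⊤ then 0 else (ω T.toNat).elim 0 (fun y => (φ y : ℝ≥0∞))

/-- `(Pφ)(x) = ∑ y, p(x, y) φ(y)`. -/
def transOp {S : Type} (p : S → S → ℝ≥0∞) (φ : S → ℝ≥0) (x : S) : ℝ≥0∞ :=
  ∑' y, p x y * φ y

/-- `Pφ = φ`. -/
def IsHarmonic {S : Type} (p : S → S → ℝ≥0∞) (φ : S → ℝ≥0) : Prop :=
  ∀ x, transOp p φ x = φ x

/-- `Pφ ≤ φ`. -/
def IsSuperharmonic {S : Type} (p : S → S → ℝ≥0∞) (φ : S → ℝ≥0) : Prop :=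
  ∀ x, transOp p φ x ≤ φ x

instance {S : Type} (p : S → S → ℝ≥0∞) (hp : IsSubstochastic p) (x : S) :
    IsProbabilityMeasure (law p hp x) := by
  unfold law; infer_instance

/-! Two proved facts on the marginal laws; they serve to check that the matrix of the ladder process
below is substochastic. -/

theorem law_succ {S : Type} [Countable S] (p : S → S → ℝ≥0∞) (hp : IsSubstochastic p)
    (x : S) (t : ℕ) (b : Option S) :
    law p hp x {ω | ω (t + 1) = b} =
      ∑' a, law p hp x {ω | ω t = a} * stepMass p a b := by
  have hm : Measurable fun ω : ℕ → Option S => ω (t + 1) := measurable_pi_apply (t + 1)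
  have h1 : law p hp x {ω | ω (t + 1) = b} =
      ∫⁻ w, pathKernel p hp t w {b}
        ∂(Kernel.partialTraj (X := fun _ => Option S) (pathKernel p hp) 0 t (fun _ => some x)) := by
    rw [← Kernel.comp_apply' _ _ _ (MeasurableSet.singleton b),
      ← Kernel.map_traj_succ_self (X := fun _ => Option S) (κ := pathKernel p hp) (a := t),
      ← Kernel.map_comp, Kernel.traj_comp_partialTraj (Nat.zero_le t),
      Kernel.map_apply' _ hm _ (MeasurableSet.singleton b)]
    rfl
  rw [h1, ← Kernel.traj_map_frestrictLe_apply,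
    lintegral_map (Kernel.measurable_coe _ (MeasurableSet.singleton b)) (by fun_prop)]
  have h2 : ∀ ω : ℕ → Option S,
      pathKernel p hp t (Preorder.frestrictLe (π := fun _ => Option S) t ω) {b} =
        stepMass p (ω t) b := by
    intro ω
    change (stepPMF p hp (ω t)).toMeasure {b} = _
    rw [PMF.toMeasure_apply_singleton _ _ (MeasurableSet.singleton b)]
    rfl
  simp_rw [h2]
  change ∫⁻ ω, (fun a => stepMass p a b) (ω t) ∂(law p hp x) = _
  rw [← lintegral_map (f := fun a => stepMass p a b) (g := fun ω : ℕ → Option S => ω t)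
    Measurable.of_discrete (measurable_pi_apply _), lintegral_countable']
  refine tsum_congr fun a => ?_
  have hm : Measurable fun ω : ℕ → Option S => ω t := measurable_pi_apply t
  rw [Measure.map_apply hm (MeasurableSet.singleton a), mul_comm]
  rfl

theorem tsum_green_mul_le {S : Type} [Countable S] (p : S → S → ℝ≥0∞) (hp : IsSubstochastic p)
    (x : S) : ∑' y, green p hp x y * (1 - ∑' z, p y z) ≤ 1 := by
  have h : ∀ n : ℕ, ∑ t ∈ Finset.range n,
      ∑' y, law p hp x {ω | ω t = some y} * (1 - ∑' z, p y z) ≤ law p hp x {ω | ω n = none} := by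
    intro n
    induction n with
    | zero => simp
    | succ n ih =>
      rw [Finset.sum_range_succ, law_succ, tsum_option']
      simp only [stepMass, mul_one]
      gcongr
  simp_rw [green, ← ENNReal.tsum_mul_right]
  rw [ENNReal.tsum_comm, ENNReal.tsum_eq_iSup_nat]
  exact iSup_le fun n => (h n).trans prob_le_one

end SubMarkov

/-! ### The random walk on `ℤ^d` killed on leaving a sub-semigroup -/

namespace KilledWalk

variable {d : ℕ}

/-- The inclusion `ℤ^d → ℝ^d`. -/
def toReal (x : Fin d → ℤ) : EuclideanSpace ℝ (Fin d) := WithLp.toLp 2 (fun i => (x i : ℝ))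

/-- `E = closure(C) ∩ ℤ^d` for a non-empty convex cone `C`, as a sub-semigroup of `ℤ^d` with `0`. -/
def coneLattice (C : ConvexCone ℝ (EuclideanSpace ℝ (Fin d)))
    (hC : (C : Set (EuclideanSpace ℝ (Fin d))).Nonempty) : AddSubmonoid (Fin d → ℤ) where
  carrier := {x | toReal x ∈ closure (C : Set (EuclideanSpace ℝ (Fin d)))}
  zero_mem' := by
    obtain ⟨v, hv⟩ := hC
    have h0 : toReal (0 : Fin d → ℤ) = 0 := by ext i; simp [toReal]
    rw [Set.mem_ofPred_eq, h0]
    have ht : Tendsto (fun c : ℝ => c • v) (𝓝[>] 0) (𝓝 0) := by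
      have hc : Continuous fun c : ℝ => c • v := by fun_prop
      simpa using (hc.tendsto 0).mono_left (nhdsWithin_le_nhds (s := Set.Ioi 0))
    exact mem_closure_of_tendsto ht
      (eventually_nhdsWithin_of_forall fun c hc => C.smul_mem hc hv)
  add_mem' := by
    intro x y hx hy
    have h : toReal (x + y) = toReal x + toReal y := by ext i; simp [toReal]
    rw [Set.mem_ofPred_eq, h]
    exact C.closure.add_mem hx hy

/-- The transition probabilities `p(x, y) = μ(y - x)`, `x, y ∈ E`. -/
def stepProb (μ : PMF (Fin d → ℤ)) (E : AddSubmonoid (Fin d → ℤ)) (x y : E) : ℝ≥0∞ :=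
  μ ((y : Fin d → ℤ) - x)

theorem stepProb_substochastic (μ : PMF (Fin d → ℤ)) (E : AddSubmonoid (Fin d → ℤ)) :
    SubMarkov.IsSubstochastic (stepProb μ E) := by
  intro x
  rw [← μ.tsum_coe]
  exact ENNReal.tsum_comp_le_tsum_of_injective
    (f := fun y : E => (y : Fin d → ℤ) - x)
    (fun a b h => Subtype.ext (sub_left_injective h)) μ

/-- The law `ℙ_x` of the killed walk `(X(t))` started at `x`. -/
def walkLaw (μ : PMF (Fin d → ℤ)) (E : AddSubmonoid (Fin d → ℤ)) (x : E) :
    Measure (ℕ → Option E) :=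
  SubMarkov.law (stepProb μ E) (stepProb_substochastic μ E) x

/-- `b ∈ E + a` for `a, b ∈ E ∪ {ϑ}`; it fails as soon as `a` or `b` is `ϑ`. -/
def InShift (E : AddSubmonoid (Fin d → ℤ)) (a b : Option E) : Prop :=
  ∃ x z : E, a = some x ∧ b = some (z + x)

/-- `η_u`: the first time `t ≥ 1` with `X(t) ∉ E + u`. -/
def shiftExitTime (E : AddSubmonoid (Fin d → ℤ)) (u : E) (ω : ℕ → Option E) : ℕ∞ :=
  ⨅ (t : ℕ) (_ : 1 ≤ t ∧ ¬ InShift E (some u) (ω t)), (t : ℕ∞)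

/-- The ladder times: `t_0 = 0`, and `t_{k+1}` is the first time `n > t_k` with
`X(n) ∉ E + X(t_k)` if `t_k < ∞`, and `∞` otherwise. -/
def ladderTime (E : AddSubmonoid (Fin d → ℤ)) (ω : ℕ → Option E) : ℕ → ℕ∞
  | 0 => 0
  | k + 1 =>
      if ladderTime E ω k = ⊤ then ⊤
      else ⨅ (n : ℕ) (_ : ladderTime E ω k < n ∧
        ¬ InShift E (ω (ladderTime E ω k).toNat) (ω n)), (n : ℕ∞)

open Classical in
/-- `a_u(x, y)`: `p(x + u, y) - p(x, y - u)` if `y ∈ E + u`, and `p(x + u, y)` otherwise. -/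
def aCoeff (μ : PMF (Fin d → ℤ)) (E : AddSubmonoid (Fin d → ℤ)) (u x y : E) : ℝ≥0∞ :=
  if h : (y : Fin d → ℤ) - u ∈ E then
    stepProb μ E (x + u) y - stepProb μ E x ⟨(y : Fin d → ℤ) - u, h⟩
  else stepProb μ E (x + u) y

/-- The matrix of the ladder process: `p_H(x, y) = ∑ z, G(0, z) a_x(z, y)`. -/
def ladderProb (μ : PMF (Fin d → ℤ)) (E : AddSubmonoid (Fin d → ℤ)) (x y : E) : ℝ≥0∞ :=
  ∑' z : E, SubMarkov.green (stepProb μ E) (stepProb_substochastic μ E) 0 z * aCoeff μ E x z y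

theorem tsum_aCoeff_le (μ : PMF (Fin d → ℤ)) (E : AddSubmonoid (Fin d → ℤ)) (u x : E) :
    ∑' y, aCoeff μ E u x y ≤ 1 - ∑' y, stepProb μ E x y := by
  refine ENNReal.le_sub_of_add_le_right
    ((stepProb_substochastic μ E x).trans_lt ENNReal.one_lt_top).ne ?_
  have hinj : Function.Injective (fun z : E => z + u) := add_left_injective u
  have h1 : ∀ z : E, stepProb μ E (x + u) (z + u) = stepProb μ E x z := by
    intro z; simp [stepProb]
  have h2 : ∀ y, aCoeff μ E u x y =
      (Set.range (fun z : E => z + u))ᶜ.indicator (stepProb μ E (x + u)) y := by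
    intro y
    unfold aCoeff
    split_ifs with h
    · have hs : (⟨(y : Fin d → ℤ) - u, h⟩ : E) + u = y := Subtype.ext (by simp)
      rw [Set.indicator_of_notMem (not_not_intro ⟨_, hs⟩), ← h1, hs, tsub_self]
    · rw [Set.indicator_of_mem]
      rintro ⟨z, rfl⟩
      exact h (by simp)
  have h3 : ∑' y, stepProb μ E x y =
      ∑' y, (Set.range (fun z : E => z + u)).indicator (stepProb μ E (x + u)) y := by
    rw [← tsum_subtype, ← (Equiv.ofInjective _ hinj).tsum_eq]
    exact tsum_congr fun z => (h1 z).symm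
  rw [h3, ← ENNReal.tsum_add]
  simp_rw [h2]
  simp only [Set.indicator_compl_add_self_apply]
  exact stepProb_substochastic μ E (x + u)

theorem ladderProb_substochastic (μ : PMF (Fin d → ℤ)) (E : AddSubmonoid (Fin d → ℤ)) :
    SubMarkov.IsSubstochastic (ladderProb μ E) := by
  intro x
  unfold ladderProb
  rw [ENNReal.tsum_comm]
  simp_rw [ENNReal.tsum_mul_left]
  refine le_trans (ENNReal.tsum_le_tsum fun z => ?_)
    (SubMarkov.tsum_green_mul_le (stepProb μ E) (stepProb_substochastic μ E) 0)
  gcongr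
  exact tsum_aCoeff_le μ E x z

/-- The renewal function `V(x) = 𝔼_x(𝒯_ϑ)`, the expected killing time of the ladder process, which
is the Markov chain with transition matrix `p_H`. -/
def renewal (μ : PMF (Fin d → ℤ)) (E : AddSubmonoid (Fin d → ℤ)) (x : E) : ℝ≥0∞ :=
  SubMarkov.meanKillingTime (ladderProb μ E) (ladderProb_substochastic μ E) x

/-- The communication condition: for some `κ > 0` and some finite set `𝓔₀` on which `μ` is positive,
any two distinct points `x, y` of `E` are joined by a path in `E` with at most `κ |y - x|` steps, all
of them in `𝓔₀`. -/
def Communication (μ : PMF (Fin d → ℤ)) (E : AddSubmonoid (Fin d → ℤ)) : Prop :=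
  ∃ (κ : ℝ) (E₀ : Finset (Fin d → ℤ)), 0 < κ ∧ (∀ e ∈ E₀, 0 < μ e) ∧
    ∀ x y : E, x ≠ y → ∃ (n : ℕ) (s : ℕ → E), s 0 = x ∧ s n = y ∧
      (n : ℝ) ≤ κ * ‖toReal (y : Fin d → ℤ) - toReal (x : Fin d → ℤ)‖ ∧
      ∀ j < n, ((s (j + 1) : Fin d → ℤ) - s j) ∈ E₀

/-- The jump generating function `R(α) = ∑ x, μ(x) exp ⟨α, x⟩`, with values in `[0, ∞]`. -/
def jumpGen (μ : PMF (Fin d → ℤ)) (α : EuclideanSpace ℝ (Fin d)) : ℝ≥0∞ :=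
  ∑' x : Fin d → ℤ, μ x * ENNReal.ofReal (Real.exp (inner ℝ α (toReal x)))

end KilledWalk

end

set_option linter.unusedSectionVars false

/-! Write `P` for the killed walk, `Q` for the ladder matrix and `T_u h = lim P^n h(· + u)`. For
harmonic `h`, `T_u h` is the greatest harmonic minorant of `h(· + u)`. The heart of the proof is
`shiftLim_eq_self`: `T_u h = h` for every positive harmonic `h` and every `u`. The Riesz
decomposition of `h(· + u)` then reads `h(x + u) = h(x)` plus the potential at `x` of what is
collected on leaving `E + u`, which is the exit formula. At `x = 0` it becomes `h = h(0) + Q h`, and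
iterating this gives `h = h(0) V + lim Q^n h`.

If `T_u h ≠ h`, no integral representation is needed to get a contradiction. A functional `σ (T_u
g(x₀) - λ g(x₀))`, positive at `h` and with `λ ≠ 1`, is nearly maximized over the harmonic `g ≤ h`.
Near-maximality makes it nearly non-negative on every `T_y g`, and a limit of `y ↦ T_y g(x₀)` is a
super harmonic function whose logarithm has increments along `u` bounded away from `0` with a fixed
sign (`exists_superharmonic_of_signed`). Averaging the logarithm over translates keeps `exp` of it
super harmonic, by convexity of `exp`, and in the limit makes it affine (`exists_hasIncrement`,
`sub_eq_sum_of_hasIncrement`). A super harmonic `exp ⟨α, ·⟩` forces `R(α) ≤ 1` (`jumpGen_le_one`),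
hence `α = 0`, against the non-zero rate.

For the dichotomy, let `s` be the mean killing time. The same shift decomposition gives `s(0) V ≤ s
≤ s(0) V`, the upper bound also in truncated form. If `s(0) = ∞`, comparing `h` with the truncated
times annihilates the `Q`-harmonic part. If `s(z) < ∞` and `h = h(0) V`, then `h ≤ h(0) s`, while
`P^n s(z) → 0`. -/

namespace SubMarkov

/-! ### The action of a non-negative matrix on functions -/

section MatOp

variable {S : Type} {p : S → S → ℝ≥0∞}

/-- The action `φ ↦ (x ↦ ∑ y, p(x, y) φ(y))` of a non-negative matrix. -/
noncomputable def matOp (p : S → S → ℝ≥0∞) (φ : S → ℝ≥0∞) (x : S) : ℝ≥0∞ := ∑' y, p x y * φ y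

theorem matOp_mono (p : S → S → ℝ≥0∞) : Monotone (matOp p) := fun _ _ h _ =>
  ENNReal.tsum_le_tsum fun y => mul_le_mul_right (h y) _

theorem matOp_iterate_mono (p : S → S → ℝ≥0∞) (n : ℕ) : Monotone (matOp p)^[n] :=
  (matOp_mono p).iterate n

theorem matOp_add (φ ψ : S → ℝ≥0∞) : matOp p (φ + ψ) = matOp p φ + matOp p ψ := by
  funext x
  simp only [matOp, Pi.add_apply, mul_add, ENNReal.tsum_add]

theorem matOp_smul (c : ℝ≥0∞) (φ : S → ℝ≥0∞) : matOp p (c • φ) = c • matOp p φ := by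
  funext x
  simp only [matOp, Pi.smul_apply, smul_eq_mul, ← ENNReal.tsum_mul_left]
  exact tsum_congr fun y => mul_left_comm _ _ _

theorem matOp_tsum {ι : Type*} (f : ι → S → ℝ≥0∞) :
    matOp p (fun x => ∑' i, f i x) = fun x => ∑' i, matOp p (f i) x := by
  funext x
  simp only [matOp, ← ENNReal.tsum_mul_left]
  exact ENNReal.tsum_comm

theorem matOp_iterate_add (n : ℕ) (φ ψ : S → ℝ≥0∞) :
    (matOp p)^[n] (φ + ψ) = (matOp p)^[n] φ + (matOp p)^[n] ψ := by
  induction n generalizing φ ψ with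
  | zero => rfl
  | succ n ih => simp only [Function.iterate_succ_apply, matOp_add, ih]

theorem matOp_iterate_smul (n : ℕ) (c : ℝ≥0∞) (φ : S → ℝ≥0∞) :
    (matOp p)^[n] (c • φ) = c • (matOp p)^[n] φ := by
  induction n generalizing φ with
  | zero => rfl
  | succ n ih => simp only [Function.iterate_succ_apply, matOp_smul, ih]

theorem matOp_iterate_tsum {ι : Type*} (n : ℕ) (f : ι → S → ℝ≥0∞) :
    (matOp p)^[n] (fun x => ∑' i, f i x) = fun x => ∑' i, (matOp p)^[n] (f i) x := by
  induction n generalizing f with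
  | zero => rfl
  | succ n ih => simp only [Function.iterate_succ_apply, matOp_tsum, ih]

theorem matOp_finsetSum {ι : Type*} (s : Finset ι) (f : ι → S → ℝ≥0∞) :
    matOp p (fun x => ∑ i ∈ s, f i x) = fun x => ∑ i ∈ s, matOp p (f i) x := by
  simp_rw [← Finset.tsum_subtype]
  exact matOp_tsum _

/-- Monotone convergence from above for the counting measure on `S`; this is where finiteness of the
first term enters. An infinite entry of `p` is harmless, since finiteness forces `f 0` to vanish
there. -/
theorem matOp_iInf {f : ℕ → S → ℝ≥0∞} (hf : Antitone f) {x : S} (h0 : matOp p (f 0) x ≠ ⊤) :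
    matOp p (fun y => ⨅ n, f n y) x = ⨅ n, matOp p (f n) x := by
  let _ : MeasurableSpace S := ⊤
  have : MeasurableSingletonClass S := ⟨fun _ => trivial⟩
  simp only [matOp] at h0 ⊢
  simp only [← lintegral_count] at h0 ⊢
  have htop : ∀ y, p x y * f 0 y ≠ ⊤ := by
    simp only [lintegral_count] at h0
    exact fun y => ENNReal.ne_top_of_tsum_ne_top h0 y
  rw [← lintegral_iInf (f := fun n y => p x y * f n y) (fun n => measurable_from_top)
    (fun m n hmn y => mul_le_mul_right (hf hmn y) _) h0]
  refine lintegral_congr fun y => ?_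
  rcases eq_or_ne (p x y) ⊤ with hp | hp
  · have h1 : f 0 y = 0 := by
      by_contra hne
      exact htop y (by rw [hp, ENNReal.top_mul hne])
    have h2 : ∀ n, f n y = 0 := fun n => le_antisymm ((hf (Nat.zero_le n) y).trans h1.le) bot_le
    simp [h2]
  · exact ENNReal.mul_iInf (fun h => absurd h hp)

/-- Partial sums of the potential of `φ`. -/
theorem sum_range_succ_matOp (n : ℕ) (φ : S → ℝ≥0∞) (x : S) :
    ∑ t ∈ Finset.range (n + 1), (matOp p)^[t] φ x =
      φ x + matOp p (fun y => ∑ t ∈ Finset.range n, (matOp p)^[t] φ y) x := by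
  rw [Finset.sum_range_succ', matOp_finsetSum, add_comm]
  simp only [Function.iterate_succ_apply', Function.iterate_zero, id]

theorem matOp_iterate_le_of_le {φ : S → ℝ≥0∞} (h : matOp p φ ≤ φ) (n : ℕ) :
    (matOp p)^[n] φ ≤ φ := by
  induction n with
  | zero => exact le_rfl
  | succ n ih =>
    rw [Function.iterate_succ_apply']
    exact (matOp_mono p ih).trans h

theorem matOp_iterate_antitone {φ : S → ℝ≥0∞} (h : matOp p φ ≤ φ) :
    Antitone fun n => (matOp p)^[n] φ := by
  refine antitone_nat_of_succ_le fun n => ?_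
  rw [Function.iterate_succ_apply]
  exact matOp_iterate_mono p n h

/-- The limit of the iterates of a finite super harmonic function is harmonic. -/
theorem matOp_iInf_iterate {φ : S → ℝ≥0∞} (h : matOp p φ ≤ φ) (hfin : ∀ x, φ x ≠ ⊤) :
    matOp p (fun x => ⨅ n, (matOp p)^[n] φ x) = fun x => ⨅ n, (matOp p)^[n] φ x := by
  funext x
  have hanti := matOp_iterate_antitone h
  have h0 : matOp p ((matOp p)^[0] φ) x ≠ ⊤ := ne_top_of_le_ne_top (hfin x) (h x)
  refine (matOp_iInf (f := fun n => (matOp p)^[n] φ) hanti h0).trans ?_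
  simp_rw [← Function.iterate_succ_apply' (matOp p)]
  exact le_antisymm (le_iInf fun n => (iInf_le _ n).trans (hanti (Nat.le_succ n) x))
    (le_iInf fun n => iInf_le _ (n + 1))

theorem matOp_iterate_eq {φ : S → ℝ≥0∞} (h : matOp p φ = φ) (n : ℕ) :
    (matOp p)^[n] φ = φ := Function.iterate_fixed h n

theorem matOp_one_le (hp : IsSubstochastic p) : matOp p 1 ≤ 1 := fun x => by
  simpa [matOp] using hp x

theorem le_sum_add_matOp_iterate {φ f : S → ℝ≥0∞} (h : φ ≤ f + matOp p φ) (n : ℕ) (x : S) :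
    φ x ≤ ∑ t ∈ Finset.range n, (matOp p)^[t] f x + (matOp p)^[n] φ x := by
  induction n with
  | zero => simp
  | succ n ih =>
    refine ih.trans ?_
    rw [Finset.sum_range_succ, Function.iterate_succ_apply, add_assoc]
    gcongr
    have := matOp_iterate_mono p n h x
    rwa [matOp_iterate_add] at this

theorem sum_matOp_iterate_le {φ f : S → ℝ≥0∞} (h : f + matOp p φ ≤ φ) (n : ℕ) (x : S) :
    ∑ t ∈ Finset.range n, (matOp p)^[t] f x + (matOp p)^[n] φ x ≤ φ x := by
  induction n with
  | zero => simp
  | succ n ih =>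
    refine le_trans ?_ ih
    rw [Finset.sum_range_succ, Function.iterate_succ_apply, add_assoc]
    gcongr
    have := matOp_iterate_mono p n h x
    rwa [matOp_iterate_add] at this

/-- A function with `φ = f + P φ` is the sum of the partial potential of `f` and `P^n φ`. -/
theorem eq_sum_add_matOp_iterate {φ f : S → ℝ≥0∞} (h : φ = f + matOp p φ) (n : ℕ) (x : S) :
    φ x = ∑ t ∈ Finset.range n, (matOp p)^[t] f x + (matOp p)^[n] φ x :=
  le_antisymm (le_sum_add_matOp_iterate h.le n x) (sum_matOp_iterate_le h.ge n x)

end MatOp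

/-! ### Shift-invariant matrices on a commutative semigroup -/

section Shift

variable {M : Type} [AddCommMonoid M] [IsCancelAdd M] {p : M → M → ℝ≥0∞}

/-- `p(x + u, y + u) = p(x, y)`. -/
def IsShiftInvariant (p : M → M → ℝ≥0∞) : Prop := ∀ x y u, p (x + u) (y + u) = p x y

open Classical in
/-- The contribution to `(P φ)(x + u)` of the jumps that leave `M + u`. -/
noncomputable def exitOp (p : M → M → ℝ≥0∞) (u : M) (φ : M → ℝ≥0∞) (x : M) : ℝ≥0∞ :=
  ∑' y, (Set.range (fun z : M => z + u))ᶜ.indicator (p (x + u)) y * φ y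

theorem tsum_range_add (f : M → ℝ≥0∞) (u : M) :
    ∑' y, (Set.range (fun z : M => z + u)).indicator f y = ∑' z, f (z + u) := by
  rw [← tsum_subtype, ← (Equiv.ofInjective _ (add_left_injective u)).tsum_eq]
  rfl

/-- Jumps from `x + u` are split according to whether they land in `M + u`; by shift invariance
those that do are the jumps from `x`. -/
theorem matOp_apply_add (hp : IsShiftInvariant p) (φ : M → ℝ≥0∞) (x u : M) :
    matOp p φ (x + u) = matOp p (fun y => φ (y + u)) x + exitOp p u φ x := by
  have h1 : matOp p (fun y => φ (y + u)) x =
      ∑' y, (Set.range (fun z : M => z + u)).indicator (fun y => p (x + u) y * φ y) y := by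
    rw [tsum_range_add]
    exact tsum_congr fun y => by rw [hp]
  rw [h1, exitOp, ← ENNReal.tsum_add]
  refine tsum_congr fun y => ?_
  by_cases hy : y ∈ Set.range (fun z : M => z + u)
  · rw [Set.indicator_of_mem hy, Set.indicator_of_notMem (not_not_intro hy)]; simp
  · rw [Set.indicator_of_notMem hy, Set.indicator_of_mem (Set.mem_compl hy), zero_add]

theorem exitOp_mono (p : M → M → ℝ≥0∞) (u : M) : Monotone (exitOp p u) := fun _ _ h _ =>
  ENNReal.tsum_le_tsum fun y => mul_le_mul_right (h y) _

/-- Killing on leaving `M + u` instead of `M` only loses mass. -/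
theorem matOp_iterate_shift_le (hp : IsShiftInvariant p) (n : ℕ) (φ : M → ℝ≥0∞) (u x : M) :
    (matOp p)^[n] (fun y => φ (y + u)) x ≤ (matOp p)^[n] φ (x + u) := by
  induction n generalizing x with
  | zero => exact le_rfl
  | succ n ih =>
    simp only [Function.iterate_succ_apply']
    rw [matOp_apply_add hp]
    exact (matOp_mono p ih x).trans le_self_add

/-- The action of the ladder matrix, in terms of the potential of the exit contributions. -/
noncomputable def ladderOp (p : M → M → ℝ≥0∞) (φ : M → ℝ≥0∞) (u : M) : ℝ≥0∞ :=
  ∑' t, (matOp p)^[t] (exitOp p u φ) 0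

end Shift

end SubMarkov

namespace SubMarkov

/-! ### The Markov property -/

section Law

variable {S : Type} [Countable S] {p : S → S → ℝ≥0∞} {hp : IsSubstochastic p}

/-- Such a function factors through finitely many coordinates, whose product is a countable discrete
space. -/
theorem measurable_of_dependsOn {β : Type*} [MeasurableSpace β] {n : ℕ}
    {Φ : (ℕ → Option S) → β} (hΦ : DependsOn Φ (Set.Iic n)) : Measurable Φ := by
  have h : Φ = (fun w : Π _ : Finset.Iic n, Option S =>
      Φ (Function.updateFinset (fun _ => none) (Finset.Iic n) w)) ∘
        Preorder.frestrictLe (π := fun _ => Option S) n := by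
    funext ω
    refine hΦ fun i hi => ?_
    have hi' : i ∈ Finset.Iic n := Finset.mem_Iic.2 hi
    simp [Function.updateFinset, Set.mem_Iic.1 hi]
  rw [h]
  exact Measurable.of_discrete.comp (Preorder.measurable_frestrictLe n)

/-- The Markov property at time `n`. -/
theorem lintegral_law_mul_succ (x : S) (n : ℕ) {Φ : (ℕ → Option S) → ℝ≥0∞}
    (hΦ : DependsOn Φ (Set.Iic n)) (ψ : Option S → ℝ≥0∞) :
    ∫⁻ ω, Φ ω * ψ (ω (n + 1)) ∂(law p hp x) =
      ∫⁻ ω, Φ ω * ∑' b, stepMass p (ω n) b * ψ b ∂(law p hp x) := by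
  have hψ : ∀ t : ℕ, Measurable fun ω : ℕ → Option S => ψ (ω t) := fun t =>
    (Measurable.of_discrete (f := ψ)).comp (measurable_pi_apply t)
  have hm : Measurable fun ω : ℕ → Option S => Φ ω * ψ (ω (n + 1)) :=
    (measurable_of_dependsOn hΦ).mul (hψ _)
  -- `Φ` read as a function of the past; the coordinates after `n` are irrelevant and set to `none`.
  set Φ' : (Π _ : Finset.Iic n, Option S) → ℝ≥0∞ := fun w =>
    Φ (Function.updateFinset (fun _ => none) (Finset.Iic n) w) with hΦ'
  have hupd : ∀ (w : Π _ : Finset.Iic n, Option S) (ω : ℕ → Option S),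
      Φ (Function.updateFinset ω (Finset.Iic n) w) = Φ' w := fun w ω =>
    hΦ fun i hi => by simp [Function.updateFinset, Set.mem_Iic.1 hi]
  have hrestr : ∀ ω, Φ' (Preorder.frestrictLe (π := fun _ => Option S) n ω) = Φ ω := fun ω =>
    hΦ fun i hi => by simp [Function.updateFinset, Set.mem_Iic.1 hi]
  have hinner : ∀ w : Π _ : Finset.Iic n, Option S,
      ∫⁻ ω, Φ ω * ψ (ω (n + 1))
        ∂(Kernel.traj (X := fun _ => Option S) (pathKernel p hp) n w) =
      Φ' w * ∑' b, stepMass p (w ⟨n, Finset.mem_Iic.2 le_rfl⟩) b * ψ b := by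
    intro w
    rw [Kernel.lintegral_traj w hm]
    have h1 : ∀ ω : ℕ → Option S, Function.updateFinset ω (Finset.Iic n) w (n + 1) = ω (n + 1) :=
      fun ω => by simp [Function.updateFinset]
    simp_rw [hupd, h1]
    rw [lintegral_const_mul _ (hψ _)]
    congr 1
    have h2 := Kernel.map_traj_succ_self (X := fun _ => Option S) (κ := pathKernel p hp) (a := n)
    have h3 : ∫⁻ b, ψ b ∂(pathKernel p hp n w) = ∫⁻ ω, ψ (ω (n + 1))
        ∂(Kernel.traj (X := fun _ => Option S) (pathKernel p hp) n w) := by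
      rw [← h2, Kernel.lintegral_map _ (by fun_prop) _ Measurable.of_discrete]
    rw [← h3, lintegral_countable']
    refine tsum_congr fun b => ?_
    rw [mul_comm]
    congr 1
    change (stepPMF p hp (w ⟨n, _⟩)).toMeasure {b} = _
    rw [PMF.toMeasure_apply_singleton _ _ (MeasurableSet.singleton b)]
    rfl
  unfold law
  rw [← Kernel.traj_comp_partialTraj (Nat.zero_le n), Kernel.lintegral_comp _ _ _ hm]
  simp_rw [hinner]
  rw [Kernel.traj_comp_partialTraj (Nat.zero_le n), ← Kernel.traj_map_frestrictLe_apply,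
    lintegral_map Measurable.of_discrete (Preorder.measurable_frestrictLe n)]
  simp_rw [hrestr]
  rfl

theorem ae_law_zero (x : S) : ∀ᵐ ω ∂(law p hp x), ω 0 = some x := by
  have h := Kernel.traj_map_frestrictLe_apply (X := fun _ => Option S) (κ := pathKernel p hp) 0 0
    (fun _ => some x)
  rw [Kernel.partialTraj_self, Kernel.id_apply] at h
  have h2 : ∀ᵐ w ∂((law p hp x).map (Preorder.frestrictLe (π := fun _ => Option S) 0)),
      w ⟨0, Finset.mem_Iic.2 le_rfl⟩ = some x := by
    unfold law
    rw [h, ae_dirac_iff (Set.to_countable _).measurableSet]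
  exact ae_of_ae_map (Preorder.measurable_frestrictLe 0).aemeasurable h2

/-- Extension of a function by `0` at the cemetery. -/
def extendZero (φ : S → ℝ≥0∞) (a : Option S) : ℝ≥0∞ := a.elim 0 φ

theorem tsum_stepMass_mul_extendZero (φ : S → ℝ≥0∞) (a : Option S) :
    ∑' b, stepMass p a b * extendZero φ b = extendZero (matOp p φ) a := by
  rw [tsum_option']
  cases a <;> simp [extendZero, stepMass, matOp]

/-- The marginal laws are given by the powers of the transition matrix. -/
theorem lintegral_extendZero_law (x : S) (n : ℕ) (φ : S → ℝ≥0∞) :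
    ∫⁻ ω, extendZero φ (ω n) ∂(law p hp x) = (matOp p)^[n] φ x := by
  induction n generalizing φ with
  | zero =>
    rw [lintegral_congr_ae (g := fun _ => φ x)
      ((ae_law_zero x).mono fun ω h => by simp [h, extendZero])]
    simp
  | succ n ih =>
    have h := lintegral_law_mul_succ (hp := hp) x n (Φ := fun _ => 1)
      ((dependsOn_const _).mono (Set.empty_subset _)) (extendZero φ)
    simp only [one_mul, tsum_stepMass_mul_extendZero] at h
    rw [h, ih, Function.iterate_succ_apply]

/-- The Markov property is applied to the indicator of being at the cemetery at time `n` and in `S`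
at time `n + 1`; its integral is zero. -/
theorem ae_law_absorbed (x : S) :
    ∀ᵐ ω ∂(law p hp x), ∀ n, ω n = none → ω (n + 1) = none := by
  classical
  rw [ae_all_iff]
  intro n
  have h := lintegral_law_mul_succ (hp := hp) x n (Φ := fun ω => if ω n = none then 1 else 0)
    (fun ω ω' h => by simp [h n (Set.mem_Iic.2 le_rfl)]) (extendZero 1)
  have h0 : ∀ ω : ℕ → Option S,
      (if ω n = none then (1 : ℝ≥0∞) else 0) * ∑' b, stepMass p (ω n) b * extendZero 1 b = 0 := by
    intro ω
    rw [tsum_stepMass_mul_extendZero]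
    cases hω : ω n <;> simp [extendZero]
  simp_rw [h0, lintegral_zero] at h
  have hd : DependsOn (fun ω : ℕ → Option S =>
      (if ω n = none then (1 : ℝ≥0∞) else 0) * extendZero 1 (ω (n + 1))) (Set.Iic (n + 1)) :=
    fun ω ω' h => by
      simp [h n (Set.mem_Iic.2 (Nat.le_succ n)), h (n + 1) (Set.mem_Iic.2 le_rfl)]
  rw [lintegral_eq_zero_iff (measurable_of_dependsOn hd)] at h
  filter_upwards [h] with ω hω hn
  by_contra hne
  obtain ⟨y, hy⟩ := Option.ne_none_iff_exists'.1 hne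
  simp [hn, hy, extendZero] at hω

/-- The Green function is the kernel of the potential operator. -/
theorem tsum_green_mul (x : S) (f : S → ℝ≥0∞) :
    ∑' z, green p hp x z * f z = ∑' t, (matOp p)^[t] f x := by
  simp_rw [green, ← ENNReal.tsum_mul_right]
  rw [ENNReal.tsum_comm]
  refine tsum_congr fun t => ?_
  have hm : Measurable fun ω : ℕ → Option S => ω t := measurable_pi_apply t
  rw [← lintegral_extendZero_law (hp := hp),
    ← lintegral_map (f := extendZero f) Measurable.of_discrete hm, lintegral_countable', tsum_option']
  simp only [extendZero, Option.elim_none, zero_mul, zero_add, Option.elim_some]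
  refine tsum_congr fun z => ?_
  rw [Measure.map_apply hm (MeasurableSet.singleton _), mul_comm]
  rfl

/-! ### First times -/

theorem iInf_natCast_eq_coe {P : ℕ → Prop} {n : ℕ} :
    (⨅ (t : ℕ) (_ : P t), (t : ℕ∞)) = n ↔ P n ∧ ∀ m < n, ¬ P m := by
  constructor
  · intro h
    have hlow : ∀ m < n, ¬ P m := fun m hm hP => by
      have h1 : (⨅ (t : ℕ) (_ : P t), (t : ℕ∞)) ≤ m := iInf₂_le m hP
      rw [h] at h1
      exact absurd (Nat.cast_le.1 h1) (not_le.2 hm)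
    refine ⟨?_, hlow⟩
    by_contra hn
    have h1 : ((n + 1 : ℕ) : ℕ∞) ≤ ⨅ (t : ℕ) (_ : P t), (t : ℕ∞) := by
      refine le_iInf₂ fun t ht => Nat.cast_le.2 ?_
      by_contra hlt
      rcases (Nat.lt_succ_iff.1 (not_le.1 hlt)).lt_or_eq with h2 | h2
      · exact hlow t h2 ht
      · exact hn (h2 ▸ ht)
    rw [h] at h1
    exact absurd (Nat.cast_le.1 h1) (by omega)
  · rintro ⟨h1, h2⟩
    refine le_antisymm (iInf₂_le n h1) (le_iInf₂ fun t ht => Nat.cast_le.2 ?_)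
    by_contra hlt
    exact h2 t (not_le.1 hlt) ht

/-- By absorption, the lifetime counts the times spent in `S`. Starting in `S` makes the restriction
`t ≥ 1` in the killing time immaterial. -/
theorem killingTime_eq_tsum {x : S} {ω : ℕ → Option S} (h0 : ω 0 = some x)
    (habs : ∀ n, ω n = none → ω (n + 1) = none) :
    (killingTime ω : ℝ≥0∞) = ∑' t, extendZero 1 (ω t) := by
  classical
  by_cases hex : ∃ t, ω t = none
  · set N := Nat.find hex with hN
    have hN1 : ω N = none := Nat.find_spec hex
    have hlt : ∀ t < N, ω t ≠ none := fun t ht => Nat.find_min hex ht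
    have hge : ∀ t, N ≤ t → ω t = none := fun t ht => by
      induction t, ht using Nat.le_induction with
      | base => exact hN1
      | succ k _ ih => exact habs k ih
    have hpos : 1 ≤ N := by
      by_contra h
      have : N = 0 := by omega
      rw [this, h0] at hN1
      exact Option.some_ne_none _ hN1
    have hk : killingTime ω = N :=
      iInf_natCast_eq_coe.2 ⟨⟨hpos, hN1⟩, fun m hm h => hlt m hm h.2⟩
    rw [hk, tsum_eq_sum (s := Finset.range N)]
    · rw [Finset.sum_congr rfl (g := fun _ => (1 : ℝ≥0∞))]
      · simp
      · intro t ht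
        obtain ⟨y, hy⟩ := Option.ne_none_iff_exists'.1 (hlt t (Finset.mem_range.1 ht))
        simp [hy, extendZero]
    · intro t ht
      simp [hge t (by simpa using ht), extendZero]
  · push Not at hex
    have hk : killingTime ω = ⊤ := by
      simp only [killingTime, iInf_eq_top]
      exact fun t ht => absurd ht.2 (hex t)
    have h1 : ∀ t, extendZero 1 (ω t) = 1 := fun t => by
      obtain ⟨y, hy⟩ := Option.ne_none_iff_exists'.1 (hex t)
      simp [hy, extendZero]
    simp_rw [hk, h1]
    simp

theorem meanKillingTime_eq_tsum (x : S) :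
    meanKillingTime p hp x = ∑' t, (matOp p)^[t] 1 x := by
  have hm : ∀ t : ℕ, Measurable fun ω : ℕ → Option S => extendZero (1 : S → ℝ≥0∞) (ω t) := fun t =>
    (Measurable.of_discrete (f := extendZero (1 : S → ℝ≥0∞))).comp (measurable_pi_apply t)
  have h : ∀ᵐ ω ∂(law p hp x), (killingTime ω : ℝ≥0∞) = ∑' t, extendZero 1 (ω t) := by
    filter_upwards [ae_law_zero x, ae_law_absorbed x] with ω h0 h1
    exact killingTime_eq_tsum h0 h1
  rw [meanKillingTime, lintegral_congr_ae h, lintegral_tsum fun t => (hm t).aemeasurable]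
  exact tsum_congr fun t => lintegral_extendZero_law x t 1

open Classical in
/-- The value of a function at a random time, as a sum over the values of that time. -/
noncomputable def sumAtTime (φ : S → ℝ≥0∞) (ω : ℕ → Option S) (T : ℕ∞) : ℝ≥0∞ :=
  ∑' n : ℕ, if T = n then extendZero φ (ω n) else 0

theorem sumAtTime_coe (φ : S → ℝ≥0∞) (ω : ℕ → Option S) (n : ℕ) :
    sumAtTime φ ω n = extendZero φ (ω n) := by
  classical
  rw [sumAtTime, tsum_eq_single n]
  · simp
  · intro m hm
    rw [if_neg]
    simpa using hm.symm

theorem valueAt_eq_sumAtTime (φ : S → ℝ≥0) (ω : ℕ → Option S) (T : ℕ∞) :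
    valueAt φ ω T = sumAtTime (fun y => φ y) ω T := by
  induction T using ENat.recTopCoe with
  | top => simp [valueAt, sumAtTime]
  | coe n => rw [sumAtTime_coe]; simp [valueAt, extendZero]

end Law

end SubMarkov

namespace KilledWalk

open SubMarkov

/-! ### Exit times and ladder times -/

section Exit

variable {d : ℕ} {μ : PMF (Fin d → ℤ)} {E : AddSubmonoid (Fin d → ℤ)}

theorem stepProb_isShiftInvariant : IsShiftInvariant (stepProb μ E) := by
  intro x y u
  simp [stepProb]

theorem inShift_some_iff {u : E} {b : Option E} :
    InShift E (some u) b ↔ ∃ z : E, b = some (z + u) := by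
  constructor
  · rintro ⟨x, z, hx, hz⟩
    obtain rfl := Option.some_injective _ hx
    exact ⟨z, hz⟩
  · rintro ⟨z, hz⟩
    exact ⟨u, z, rfl, hz⟩

theorem not_inShift_none_left {b : Option E} : ¬ InShift E none b := by
  rintro ⟨x, z, hx, -⟩
  exact Option.some_ne_none _ hx.symm

theorem not_inShift_none_right {a : Option E} : ¬ InShift E a none := by
  rintro ⟨x, z, -, hz⟩
  exact Option.some_ne_none _ hz.symm

open Classical in
/-- The function `z + u ↦ ψ(z)` on `E + u`, extended by `0`. -/
noncomputable def shiftExtend (u : E) (ψ : E → ℝ≥0∞) (a : Option E) : ℝ≥0∞ :=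
  if h : InShift E (some u) a then ψ (inShift_some_iff.1 h).choose else 0

theorem shiftExtend_some_add (u z : E) (ψ : E → ℝ≥0∞) :
    shiftExtend u ψ (some (z + u)) = ψ z := by
  have h : InShift E (some u) (some (z + u)) := inShift_some_iff.2 ⟨z, rfl⟩
  rw [shiftExtend, dif_pos h]
  congr 1
  exact (add_left_injective u (Option.some_injective _
    (inShift_some_iff.1 h).choose_spec)).symm

theorem shiftExtend_of_not {u : E} {a : Option E} (h : ¬ InShift E (some u) a) (ψ : E → ℝ≥0∞) :
    shiftExtend u ψ a = 0 := dif_neg h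

theorem tsum_stepMass_mul_shiftExtend (u z : E) (ψ : E → ℝ≥0∞) :
    ∑' b, stepMass (stepProb μ E) (some (z + u)) b * shiftExtend u ψ b =
      matOp (stepProb μ E) ψ z := by
  classical
  rw [tsum_option', shiftExtend_of_not not_inShift_none_right, mul_zero, zero_add]
  have h : ∀ y, stepMass (stepProb μ E) (some (z + u)) (some y) * shiftExtend u ψ (some y) =
      (Set.range fun w : E => w + u).indicator
        (fun y => stepProb μ E (z + u) y * shiftExtend u ψ (some y)) y := by
    intro y
    by_cases hy : y ∈ Set.range fun w : E => w + u
    · rw [Set.indicator_of_mem hy]; rfl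
    · rw [Set.indicator_of_notMem hy, shiftExtend_of_not, mul_zero]
      intro h
      obtain ⟨w, hw⟩ := inShift_some_iff.1 h
      exact hy ⟨w, (Option.some_injective _ hw).symm⟩
  simp_rw [h]
  rw [tsum_range_add]
  simp_rw [shiftExtend_some_add, stepProb_isShiftInvariant _ _ u]
  rfl

open Classical in
/-- The extension by `0` of the restriction of `φ` to the complement of `E + u`. -/
noncomputable def offShift (u : E) (φ : E → ℝ≥0∞) (a : Option E) : ℝ≥0∞ :=
  if InShift E (some u) a then 0 else extendZero φ a

theorem tsum_stepMass_mul_offShift (u z : E) (φ : E → ℝ≥0∞) :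
    ∑' b, stepMass (stepProb μ E) (some (z + u)) b * offShift u φ b =
      exitOp (stepProb μ E) u φ z := by
  classical
  rw [tsum_option', offShift, if_neg not_inShift_none_right]
  simp only [extendZero, Option.elim_none, mul_zero, zero_add, exitOp]
  refine tsum_congr fun y => ?_
  by_cases hy : y ∈ Set.range fun w : E => w + u
  · obtain ⟨w, rfl⟩ := hy
    rw [Set.indicator_of_notMem (not_not_intro ⟨w, rfl⟩), offShift,
      if_pos (inShift_some_iff.2 ⟨w, rfl⟩), mul_zero, zero_mul]
  · rw [Set.indicator_of_mem (Set.mem_compl hy), offShift, if_neg]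
    · rfl
    · intro h
      obtain ⟨w, hw⟩ := inShift_some_iff.1 h
      exact hy ⟨w, (Option.some_injective _ hw).symm⟩

open Classical in
/-- The indicator of staying in `E + u` at the times `m + 1, …, m + j`. -/
noncomputable def stays (u : E) (m j : ℕ) (ω : ℕ → Option E) : ℝ≥0∞ :=
  if ∀ i, m < i → i ≤ m + j → InShift E (some u) (ω i) then 1 else 0

theorem stays_dependsOn (u : E) (m j : ℕ) : DependsOn (stays u m j) (Set.Iic (m + j)) := by
  classical
  intro ω ω' h
  have : (∀ i, m < i → i ≤ m + j → InShift E (some u) (ω i)) ↔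
      ∀ i, m < i → i ≤ m + j → InShift E (some u) (ω' i) :=
    forall_congr' fun i => forall_congr' fun _ => forall_congr' fun hi => by
      rw [h i (Set.mem_Iic.2 hi)]
  exact if_congr this rfl rfl

theorem stays_zero (u : E) (m : ℕ) (ω : ℕ → Option E) : stays u m 0 ω = 1 :=
  if_pos fun i h1 h2 => absurd h1 (by omega)

/-- The factor `shiftExtend` vanishes off `E + u`, so the last constraint in `stays` is redundant.
-/
theorem stays_succ_mul (u : E) (m j : ℕ) (ψ : E → ℝ≥0∞) (ω : ℕ → Option E) :
    stays u m (j + 1) ω * shiftExtend u ψ (ω (m + j + 1)) =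
      stays u m j ω * shiftExtend u ψ (ω (m + j + 1)) := by
  classical
  by_cases h : InShift E (some u) (ω (m + j + 1))
  · congr 1
    have : (∀ i, m < i → i ≤ m + (j + 1) → InShift E (some u) (ω i)) ↔
        ∀ i, m < i → i ≤ m + j → InShift E (some u) (ω i) := by
      refine ⟨fun H i h1 h2 => H i h1 (by omega), fun H i h1 h2 => ?_⟩
      rcases eq_or_ne i (m + j + 1) with rfl | hne
      · exact h
      · exact H i h1 (by omega)
    exact if_congr this rfl rfl
  · simp [shiftExtend_of_not h]

variable {Φ : (ℕ → Option E) → ℝ≥0∞} {m : ℕ} {u z : E}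

/-- Locates the present state, so that the one-step formulas apply. The case `j = 0` rests on `hΦ`,
because `stays` says nothing about time `m` itself. -/
theorem mul_stays_eq_zero_or (hΦ : ∀ ω, Φ ω ≠ 0 → ω m = some (z + u)) (j : ℕ)
    (ω : ℕ → Option E) :
    Φ ω * stays u m j ω = 0 ∨ ∃ w : E, ω (m + j) = some (w + u) := by
  by_cases h0 : Φ ω = 0
  · exact Or.inl (by rw [h0, zero_mul])
  rcases Nat.eq_zero_or_pos j with rfl | hj
  · exact Or.inr ⟨z, hΦ ω h0⟩
  by_cases h : ∀ i, m < i → i ≤ m + j → InShift E (some u) (ω i)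
  · exact Or.inr (inShift_some_iff.1 (h (m + j) (by omega) le_rfl))
  · exact Or.inl (by rw [stays, if_neg h, mul_zero])

theorem mul_stays_dependsOn (hd : DependsOn Φ (Set.Iic m)) (u : E) (j : ℕ) :
    DependsOn (fun ω => Φ ω * stays u m j ω) (Set.Iic (m + j)) := fun ω ω' h => by
  change Φ ω * _ = Φ ω' * _
  rw [hd fun i hi => h i (Set.mem_Iic.2 ((Set.mem_Iic.1 hi).trans (Nat.le_add_right _ _))),
    stays_dependsOn u m j h]

/-- After time `m`, the walk started at `z + u` and killed on leaving `E + u` is a copy of the walk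
started at `z` and killed on leaving `E`. -/
theorem lintegral_mul_stays_mul (x : E) (hd : DependsOn Φ (Set.Iic m))
    (hΦ : ∀ ω, Φ ω ≠ 0 → ω m = some (z + u)) (j : ℕ) (ψ : E → ℝ≥0∞) :
    ∫⁻ ω, Φ ω * stays u m j ω * shiftExtend u ψ (ω (m + j)) ∂(walkLaw μ E x) =
      (∫⁻ ω, Φ ω ∂(walkLaw μ E x)) * (matOp (stepProb μ E))^[j] ψ z := by
  induction j generalizing ψ with
  | zero =>
    rw [← lintegral_mul_const _ (measurable_of_dependsOn hd)]
    refine lintegral_congr fun ω => ?_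
    by_cases h0 : Φ ω = 0
    · simp [h0]
    · rw [stays_zero, mul_one, add_zero, hΦ ω h0, shiftExtend_some_add]
      rfl
  | succ j ih =>
    rw [Function.iterate_succ_apply, ← ih]
    have h1 : ∀ ω, Φ ω * stays u m (j + 1) ω * shiftExtend u ψ (ω (m + (j + 1))) =
        Φ ω * stays u m j ω * shiftExtend u ψ (ω (m + j + 1)) := fun ω => by
      rw [mul_assoc, mul_assoc, ← add_assoc, stays_succ_mul]
    simp_rw [h1]
    unfold walkLaw
    rw [lintegral_law_mul_succ x (m + j) (mul_stays_dependsOn hd u j)]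
    refine lintegral_congr fun ω => ?_
    rcases mul_stays_eq_zero_or hΦ j ω with h | ⟨w, hw⟩
    · rw [h, zero_mul, zero_mul]
    · rw [hw, tsum_stepMass_mul_shiftExtend, shiftExtend_some_add]

/-- The law of the position at the first exit from `E + u` after time `m`. -/
theorem lintegral_mul_stays_mul_offShift (x : E) (hd : DependsOn Φ (Set.Iic m))
    (hΦ : ∀ ω, Φ ω ≠ 0 → ω m = some (z + u)) (j : ℕ) (φ : E → ℝ≥0∞) :
    ∫⁻ ω, Φ ω * stays u m j ω * offShift u φ (ω (m + j + 1)) ∂(walkLaw μ E x) =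
      (∫⁻ ω, Φ ω ∂(walkLaw μ E x)) *
        (matOp (stepProb μ E))^[j] (exitOp (stepProb μ E) u φ) z := by
  rw [← lintegral_mul_stays_mul x hd hΦ]
  unfold walkLaw
  rw [lintegral_law_mul_succ x (m + j) (mul_stays_dependsOn hd u j)]
  refine lintegral_congr fun ω => ?_
  rcases mul_stays_eq_zero_or hΦ j ω with h | ⟨w, hw⟩
  · rw [h, zero_mul, zero_mul]
  · rw [hw, tsum_stepMass_mul_offShift, shiftExtend_some_add]

theorem measurable_mul_stays_mul_offShift (hd : DependsOn Φ (Set.Iic m)) (u : E) (j : ℕ)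
    (φ : E → ℝ≥0∞) :
    Measurable fun ω => Φ ω * stays u m j ω * offShift u φ (ω (m + j + 1)) :=
  (measurable_of_dependsOn (mul_stays_dependsOn hd u j)).mul
    ((Measurable.of_discrete (f := offShift u φ)).comp (measurable_pi_apply _))

theorem lintegral_tsum_stays_mul_offShift (x : E) (hd : DependsOn Φ (Set.Iic m))
    (hΦ : ∀ ω, Φ ω ≠ 0 → ω m = some (z + u)) (φ : E → ℝ≥0∞) :
    ∫⁻ ω, ∑' j, Φ ω * stays u m j ω * offShift u φ (ω (m + j + 1)) ∂(walkLaw μ E x) =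
      (∫⁻ ω, Φ ω ∂(walkLaw μ E x)) *
        ∑' j, (matOp (stepProb μ E))^[j] (exitOp (stepProb μ E) u φ) z := by
  rw [lintegral_tsum fun j => (measurable_mul_stays_mul_offShift hd u j φ).aemeasurable,
    ← ENNReal.tsum_mul_left]
  exact tsum_congr fun j => lintegral_mul_stays_mul_offShift x hd hΦ j φ

/-- At most one term survives: the one for which `m + j + 1` is the first exit time after `m`. -/
theorem tsum_stays_mul_offShift (u : E) (m : ℕ) (φ : E → ℝ≥0∞) (ω : ℕ → Option E) :
    ∑' j, stays u m j ω * offShift u φ (ω (m + j + 1)) =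
      sumAtTime φ ω (⨅ (t : ℕ) (_ : m < t ∧ ¬ InShift E (some u) (ω t)), (t : ℕ∞)) := by
  classical
  have key : ∀ n : ℕ, (⨅ (t : ℕ) (_ : m < t ∧ ¬ InShift E (some u) (ω t)), (t : ℕ∞)) = n ↔
      (m < n ∧ ¬ InShift E (some u) (ω n)) ∧
        ∀ i < n, ¬ (m < i ∧ ¬ InShift E (some u) (ω i)) := fun n => iInf_natCast_eq_coe
  generalize (⨅ (t : ℕ) (_ : m < t ∧ ¬ InShift E (some u) (ω t)), (t : ℕ∞)) = T at key ⊢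
  have hterm : ∀ j, stays u m j ω * offShift u φ (ω (m + j + 1)) =
      if T = ((j + (m + 1) : ℕ) : ℕ∞) then extendZero φ (ω (j + (m + 1))) else 0 := by
    intro j
    have hj : m + j + 1 = j + (m + 1) := by omega
    rw [hj, stays, offShift]
    by_cases h1 : ∀ i, m < i → i ≤ m + j → InShift E (some u) (ω i)
    · rw [if_pos h1, one_mul]
      by_cases h2 : InShift E (some u) (ω (j + (m + 1)))
      · rw [if_pos h2, if_neg fun h => ((key _).1 h).1.2 h2]
      · rw [if_neg h2, if_pos]
        exact (key _).2 ⟨⟨by omega, h2⟩, fun i hi h => h.2 (h1 i h.1 (by omega))⟩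
    · rw [if_neg h1, zero_mul, if_neg]
      intro hT
      exact h1 fun i hi1 hi2 => by_contra fun hn => ((key _).1 hT).2 i (by omega) ⟨hi1, hn⟩
  have hlow : ∀ i ∈ Finset.range (m + 1), (if T = (i : ℕ∞) then extendZero φ (ω i) else 0) = 0 := by
    intro i hi
    have h1 := Finset.mem_range.1 hi
    refine if_neg fun h => ?_
    have h2 := ((key _).1 h).1.1
    omega
  have hsplit := Summable.sum_add_tsum_nat_add' (k := m + 1)
    (f := fun n : ℕ => if T = (n : ℕ∞) then extendZero φ (ω n) else 0) ENNReal.summable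
  rw [Finset.sum_eq_zero hlow, zero_add] at hsplit
  exact (tsum_congr hterm).trans hsplit

/-- The exit time from `E + u` of the walk started at `x + u`. -/
theorem lintegral_valueAt_shiftExitTime (φ : E → ℝ≥0) (x u : E) :
    ∫⁻ ω, valueAt φ ω (shiftExitTime E u ω) ∂(walkLaw μ E (x + u)) =
      ∑' t, (matOp (stepProb μ E))^[t] (exitOp (stepProb μ E) u fun y => φ y) x := by
  classical
  have h := lintegral_tsum_stays_mul_offShift (μ := μ) (m := 0) (z := x) (u := u)
    (Φ := fun ω => if ω 0 = some (x + u) then 1 else 0) (x + u)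
    (fun ω ω' h => by simp only [h 0 (Set.mem_Iic.2 le_rfl)])
    (fun ω h => by by_contra hne; simp [hne] at h) (fun y => φ y)
  have h0 : ∀ᵐ ω ∂(walkLaw μ E (x + u)), ω 0 = some (x + u) := ae_law_zero _
  have h1 : ∫⁻ ω, (if ω 0 = some (x + u) then (1 : ℝ≥0∞) else 0) ∂(walkLaw μ E (x + u)) = 1 := by
    rw [lintegral_congr_ae (g := fun _ => 1) (h0.mono fun ω hω => if_pos hω)]
    unfold walkLaw
    simp
  rw [h1, one_mul] at h
  rw [← h]
  refine lintegral_congr_ae (h0.mono fun ω hω => ?_)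
  simp only [if_pos hω, one_mul]
  rw [tsum_stays_mul_offShift, valueAt_eq_sumAtTime]
  -- The conditions `1 ≤ t` and `0 < t` agree by definition.
  rfl

theorem ladderTime_succ_eq_coe_iff (ω : ℕ → Option E) (k n : ℕ) :
    ladderTime E ω (k + 1) = n ↔ ∃ m, m < n ∧ ladderTime E ω k = m ∧
      ¬ InShift E (ω m) (ω n) ∧ ∀ i, m < i → i < n → InShift E (ω m) (ω i) := by
  rw [ladderTime]
  cases hk : ladderTime E ω k using ENat.recTopCoe with
  | top => simp
  | coe m =>
    rw [if_neg (ENat.natCast_ne_top m)]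
    simp only [ENat.toNat_natCast, Nat.cast_lt, Nat.cast_inj]
    rw [iInf_natCast_eq_coe]
    constructor
    · rintro ⟨⟨h1, h2⟩, h3⟩
      exact ⟨m, h1, rfl, h2, fun i hi1 hi2 => by_contra fun hn => h3 i hi2 ⟨hi1, hn⟩⟩
    · rintro ⟨m', h1, rfl, h2, h3⟩
      exact ⟨⟨h1, h2⟩, fun i hi h => h.2 (h3 i h.1 hi)⟩

/-- Ladder times are stopping times, which is what the Markov property at time `m` requires of
`ladderAt`. -/
theorem ladderTime_eq_coe_dependsOn (k n : ℕ) :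
    DependsOn (fun ω => ladderTime E ω k = n) (Set.Iic n) := by
  induction k generalizing n with
  | zero => exact fun _ _ _ => rfl
  | succ k ih =>
    intro ω ω' h
    simp only [ladderTime_succ_eq_coe_iff, eq_iff_iff]
    refine exists_congr fun m => and_congr_right fun hm => ?_
    have h1 : (ladderTime E ω k = m) = (ladderTime E ω' k = m) := ih m fun i hi => h i (Set.mem_Iic.2 ((Set.mem_Iic.1 hi).trans hm.le))
    rw [h1, h m (Set.mem_Iic.2 hm.le), h n (Set.mem_Iic.2 le_rfl)]
    refine and_congr_right fun _ => and_congr_right fun _ => forall_congr' fun i =>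
      forall_congr' fun _ => forall_congr' fun hi => ?_
    rw [h i (Set.mem_Iic.2 hi.le)]

open Classical in
/-- The indicator of `t_k = m`, `X(m) = u`. -/
noncomputable def ladderAt (k m : ℕ) (u : E) (ω : ℕ → Option E) : ℝ≥0∞ :=
  if ladderTime E ω k = m ∧ ω m = some u then 1 else 0

theorem ladderAt_dependsOn (k m : ℕ) (u : E) : DependsOn (ladderAt k m u) (Set.Iic m) := by
  intro ω ω' h
  have := ladderTime_eq_coe_dependsOn (E := E) k m h
  simp only [eq_iff_iff] at this
  simp only [ladderAt, this, h m (Set.mem_Iic.2 le_rfl)]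

/-- Written with `0 + u` because the next excursion, seen from the new origin `u`, is a walk started
at `0`; hence the evaluation at `0` in `ladderOp`. -/
theorem ladderAt_ne_zero {k m : ℕ} {u : E} {ω : ℕ → Option E} (h : ladderAt k m u ω ≠ 0) :
    ω m = some (0 + u) := by
  by_contra hne
  rw [zero_add] at hne
  exact h (if_neg fun h' => hne h'.2)

theorem tsum_ladderAt_mul (f : E → ℝ≥0∞) (k : ℕ) (ω : ℕ → Option E) :
    ∑' m, ∑' u, ladderAt k m u ω * f u = sumAtTime f ω (ladderTime E ω k) := by
  classical
  rw [sumAtTime]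
  refine tsum_congr fun m => ?_
  by_cases h : ladderTime E ω k = m
  · rw [if_pos h]
    cases hm : ω m with
    | none => simp [ladderAt, hm, extendZero]
    | some v =>
      rw [tsum_eq_single v]
      · simp [ladderAt, hm, h, extendZero]
      · intro u hu
        simp [ladderAt, hm, h, hu.symm]
  · simp [ladderAt, h]

/-- The sum runs over the previous ladder time `m`, the position `u` there and the number `j` of
further steps spent in `E + u`. From the cemetery the next ladder time is `m + 1`, again at the
cemetery, and both sides vanish. -/
theorem sumAtTime_ladderTime_succ {ω : ℕ → Option E}
    (habs : ∀ n, ω n = none → ω (n + 1) = none) (φ : E → ℝ≥0∞) (k : ℕ) :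
    sumAtTime φ ω (ladderTime E ω (k + 1)) = ∑' m, ∑' u, ∑' j,
      ladderAt k m u ω * stays u m j ω * offShift u φ (ω (m + j + 1)) := by
  classical
  simp only [mul_assoc, ENNReal.tsum_mul_left, tsum_stays_mul_offShift]
  cases hk : ladderTime E ω k using ENat.recTopCoe with
  | top =>
    have h1 : ladderTime E ω (k + 1) = ⊤ := by rw [ladderTime, if_pos hk]
    simp [ladderAt, hk, h1, sumAtTime]
  | coe m =>
    rw [tsum_eq_single m]
    · cases hm : ω m with
      | none =>
        have h1 : ladderTime E ω (k + 1) = (m + 1 : ℕ) := by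
          rw [ladderTime_succ_eq_coe_iff]
          exact ⟨m, Nat.lt_succ_self m, hk, hm ▸ not_inShift_none_left,
            fun i h1 h2 => absurd h1 (by omega)⟩
        rw [h1, sumAtTime_coe, habs m hm]
        simp [ladderAt, hm, extendZero]
      | some v =>
        rw [tsum_eq_single v]
        · rw [ladderAt, if_pos ⟨hk, hm⟩, one_mul, ladderTime, hk, if_neg (ENat.natCast_ne_top m)]
          simp only [ENat.toNat_natCast, Nat.cast_lt, hm]
        · intro u hu
          simp [ladderAt, hm, hu.symm]
    · intro i hi
      have : ¬ m = i := fun h => hi h.symm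
      simp [ladderAt, hk, this]

/-- The strong Markov property at the last ladder time replaces `φ` by `ladderOp φ`; the induction
therefore runs over all `φ`. -/
theorem lintegral_sumAtTime_ladderTime (φ : E → ℝ≥0∞) (x : E) (k : ℕ) :
    ∫⁻ ω, sumAtTime φ ω (ladderTime E ω k) ∂(walkLaw μ E x) =
      (ladderOp (stepProb μ E))^[k] φ x := by
  induction k generalizing φ with
  | zero =>
    have h0 : ∀ᵐ ω ∂(walkLaw μ E x), ω 0 = some x := ae_law_zero _
    rw [lintegral_congr_ae (g := fun _ => φ x)]
    · unfold walkLaw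
      simp
    · refine h0.mono fun ω hω => ?_
      have h1 : ladderTime E ω 0 = (0 : ℕ) := rfl
      simp only
      rw [h1, sumAtTime_coe, hω]
      rfl
  | succ k ih =>
    have habs : ∀ᵐ ω ∂(walkLaw μ E x), ∀ n, ω n = none → ω (n + 1) = none := ae_law_absorbed _
    rw [Function.iterate_succ_apply, ← ih,
      lintegral_congr_ae (habs.mono fun ω hω => sumAtTime_ladderTime_succ hω φ k)]
    simp_rw [← tsum_ladderAt_mul]
    have hm1 : ∀ m u, Measurable fun ω : ℕ → Option E => ∑' j,
        ladderAt k m u ω * stays u m j ω * offShift u φ (ω (m + j + 1)) := fun m u =>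
      Measurable.tsum fun j =>
        measurable_mul_stays_mul_offShift (ladderAt_dependsOn k m u) u j φ
    have hm2 : ∀ m u, Measurable fun ω : ℕ → Option E =>
        ladderAt k m u ω * ladderOp (stepProb μ E) φ u := fun m u =>
      (measurable_of_dependsOn (ladderAt_dependsOn k m u)).mul_const _
    rw [lintegral_tsum fun m => (Measurable.tsum (hm1 m)).aemeasurable,
      lintegral_tsum fun m => (Measurable.tsum (hm2 m)).aemeasurable]
    refine tsum_congr fun m => ?_
    rw [lintegral_tsum fun u => (hm1 m u).aemeasurable,
      lintegral_tsum fun u => (hm2 m u).aemeasurable]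
    refine tsum_congr fun u => ?_
    rw [lintegral_mul_const _ (measurable_of_dependsOn (ladderAt_dependsOn k m u))]
    exact lintegral_tsum_stays_mul_offShift x (ladderAt_dependsOn k m u)
      (fun ω h => ladderAt_ne_zero h) φ

/-- On `E + u` the two terms of `a_u(z, ·)` cancel by shift invariance, so only the jumps leaving `E
+ u` remain, and summing against `G(0, ·)` produces their potential at `0`. -/
theorem matOp_ladderProb (φ : E → ℝ≥0∞) :
    matOp (ladderProb μ E) φ = ladderOp (stepProb μ E) φ := by
  classical
  funext u
  have ha : ∀ z y, aCoeff μ E u z y =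
      (Set.range (fun w : E => w + u))ᶜ.indicator (stepProb μ E (z + u)) y := by
    intro z y
    unfold aCoeff
    split_ifs with h
    · have hs : (⟨(y : Fin d → ℤ) - u, h⟩ : E) + u = y := Subtype.ext (by simp)
      rw [Set.indicator_of_notMem (not_not_intro ⟨_, hs⟩),
        ← stepProb_isShiftInvariant z ⟨(y : Fin d → ℤ) - u, h⟩ u, hs, tsub_self]
    · rw [Set.indicator_of_mem]
      rintro ⟨w, rfl⟩
      exact h (by simp)
  rw [ladderOp, ← tsum_green_mul (hp := stepProb_substochastic μ E)]
  simp only [matOp, ladderProb, ← ENNReal.tsum_mul_right]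
  rw [ENNReal.tsum_comm]
  refine tsum_congr fun z => ?_
  rw [exitOp, ← ENNReal.tsum_mul_left]
  exact tsum_congr fun y => by rw [ha, mul_assoc]

theorem lintegral_valueAt_ladderTime (φ : E → ℝ≥0) (x : E) (k : ℕ) :
    ∫⁻ ω, valueAt φ ω (ladderTime E ω k) ∂(walkLaw μ E x) =
      (matOp (ladderProb μ E))^[k] (fun y => φ y) x := by
  simp_rw [valueAt_eq_sumAtTime]
  rw [lintegral_sumAtTime_ladderTime]
  rw [show ladderOp (stepProb μ E) = matOp (ladderProb μ E) from
    funext fun φ => (matOp_ladderProb φ).symm]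

theorem renewal_eq_tsum (x : E) :
    renewal μ E x = ∑' n, (matOp (ladderProb μ E))^[n] 1 x :=
  meanKillingTime_eq_tsum x

end Exit

end KilledWalk

namespace SubMarkov

/-! ### The greatest harmonic minorant of a shifted harmonic function -/

section ShiftLim

variable {M : Type} [AddCommMonoid M] [IsCancelAdd M] {p : M → M → ℝ≥0∞}

/-- `lim P^n g(· + u)`, which for `g` harmonic is the greatest harmonic minorant of `g(· + u)`. -/
noncomputable def shiftLim (p : M → M → ℝ≥0∞) (u : M) (g : M → ℝ≥0∞) (x : M) : ℝ≥0∞ :=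
  ⨅ n, (matOp p)^[n] (fun y => g (y + u)) x

/-- A finite harmonic function. -/
structure IsFiniteHarmonic (p : M → M → ℝ≥0∞) (g : M → ℝ≥0∞) : Prop where
  matOp_eq : matOp p g = g
  ne_top : ∀ x, g x ≠ ⊤

/-- Irreducibility, uniformly along shifts. -/
def IsUniformlyIrreducible (p : M → M → ℝ≥0∞) : Prop :=
  ∀ a b : M, ∃ (n : ℕ) (δ : ℝ≥0∞), δ ≠ 0 ∧ δ ≠ ⊤ ∧
    ∀ (φ : M → ℝ≥0∞) (x : M), δ * φ (b + x) ≤ (matOp p)^[n] φ (a + x)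

theorem matOp_shift_le (hp : IsShiftInvariant p) {g : M → ℝ≥0∞} (hg : matOp p g ≤ g) (u : M) :
    matOp p (fun y => g (y + u)) ≤ fun y => g (y + u) := fun x =>
  (matOp_iterate_shift_le hp 1 g u x).trans (hg (x + u))

/-- A Harnack inequality whose constant depends neither on the super harmonic function nor on the
translate. -/
theorem IsUniformlyIrreducible.harnack (hirr : IsUniformlyIrreducible p) (a b : M) :
    ∃ C : ℝ≥0, ∀ g : M → ℝ≥0∞, matOp p g ≤ g → ∀ x, g (b + x) ≤ C * g (a + x) := by
  obtain ⟨n, δ, h0, htop, h⟩ := hirr a b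
  refine ⟨δ⁻¹.toNNReal, fun g hg x => ?_⟩
  rw [ENNReal.coe_toNNReal (ENNReal.inv_ne_top.2 h0)]
  calc g (b + x) = δ⁻¹ * (δ * g (b + x)) := by
        rw [← mul_assoc, ENNReal.inv_mul_cancel h0 htop, one_mul]
    _ ≤ δ⁻¹ * g (a + x) := by
        gcongr
        exact (h g x).trans (matOp_iterate_le_of_le hg n _)

namespace IsFiniteHarmonic

variable {g k : M → ℝ≥0∞}

theorem smul (hg : IsFiniteHarmonic p g) (c : ℝ≥0) :
    IsFiniteHarmonic p ((c : ℝ≥0∞) • g) :=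
  ⟨by rw [matOp_smul, hg.1], fun x => ENNReal.mul_ne_top ENNReal.coe_ne_top (hg.2 x)⟩

theorem sub (hg : IsFiniteHarmonic p g) (hk : IsFiniteHarmonic p k) (hkg : k ≤ g) :
    IsFiniteHarmonic p (g - k) := by
  refine ⟨?_, fun x => ENNReal.sub_ne_top (hg.2 x)⟩
  -- Subtraction in `ℝ≥0∞` is truncated, so `k` is added back and then cancelled, being finite.
  have h1 : matOp p (g - k) + k = (g - k) + k := by
    nth_rewrite 2 [← hk.1]
    rw [← matOp_add, tsub_add_cancel_of_le hkg, hg.1]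
  funext x
  exact (ENNReal.add_left_inj (hk.2 x)).1 (congrFun h1 x)

theorem shift_antitone (hp : IsShiftInvariant p) (hg : IsFiniteHarmonic p g) (u : M) :
    Antitone fun n => (matOp p)^[n] (fun y => g (y + u)) :=
  matOp_iterate_antitone (matOp_shift_le hp hg.1.le u)

theorem shiftLim_le (_hg : IsFiniteHarmonic p g) (u x : M) : shiftLim p u g x ≤ g (x + u) :=
  iInf_le _ 0

theorem shiftLim (hp : IsShiftInvariant p) (hg : IsFiniteHarmonic p g) (u : M) :
    IsFiniteHarmonic p (shiftLim p u g) := by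
  exact ⟨matOp_iInf_iterate (matOp_shift_le hp hg.1.le u) fun x => hg.2 _,
    fun x => ne_top_of_le_ne_top (hg.2 _) (hg.shiftLim_le u x)⟩

/-- Maximality among harmonic minorants: `k = P^n k` stays below every iterate. -/
theorem le_shiftLim (hk : IsFiniteHarmonic p k) {u : M} (h : ∀ x, k x ≤ g (x + u)) :
    k ≤ SubMarkov.shiftLim p u g := fun x => le_iInf fun n => by
  rw [← matOp_iterate_eq hk.1 n]
  exact matOp_iterate_mono p n h x

theorem shiftLim_add (hp : IsShiftInvariant p) (hg : IsFiniteHarmonic p g)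
    (hk : IsFiniteHarmonic p k) (u : M) :
    SubMarkov.shiftLim p u (g + k) = SubMarkov.shiftLim p u g + SubMarkov.shiftLim p u k := by
  funext x
  have h : ∀ n, (matOp p)^[n] (fun y => (g + k) (y + u)) x =
      (matOp p)^[n] (fun y => g (y + u)) x + (matOp p)^[n] (fun y => k (y + u)) x := fun n =>
    congrFun (matOp_iterate_add n (fun y => g (y + u)) fun y => k (y + u)) x
  refine (iInf_congr h).trans ?_
  refine (ENNReal.iInf_add_iInf fun i j => ⟨max i j, ?_⟩).symm
  exact add_le_add (hg.shift_antitone hp u (le_max_left i j) x)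
    (hk.shift_antitone hp u (le_max_right i j) x)

theorem shiftLim_smul (u : M) (g : M → ℝ≥0∞) {c : ℝ≥0} :
    SubMarkov.shiftLim p u ((c : ℝ≥0∞) • g) = (c : ℝ≥0∞) • SubMarkov.shiftLim p u g := by
  funext x
  have h : ∀ n, (matOp p)^[n] (fun y => ((c : ℝ≥0∞) • g) (y + u)) x =
      c * (matOp p)^[n] (fun y => g (y + u)) x := fun n =>
    congrFun (matOp_iterate_smul n (c : ℝ≥0∞) fun y => g (y + u)) x
  simp only [SubMarkov.shiftLim, Pi.smul_apply, smul_eq_mul] at h ⊢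
  rw [ENNReal.mul_iInf (fun h => absurd h ENNReal.coe_ne_top)]
  exact iInf_congr h

/-- The left side is a harmonic minorant of `g(· + u + v)`, hence at most the right side.
Conversely, each iterate of the shift by `v`, evaluated at `x + u`, dominates the corresponding
iterate of the shift by `u + v`. -/
theorem shiftLim_shiftLim (hp : IsShiftInvariant p) (hg : IsFiniteHarmonic p g) (u v : M) :
    SubMarkov.shiftLim p u (SubMarkov.shiftLim p v g) = SubMarkov.shiftLim p (u + v) g := by
  have hv := hg.shiftLim hp v
  refine le_antisymm ?_ ?_
  · refine (hv.shiftLim hp u).le_shiftLim fun x => ?_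
    rw [← add_assoc]
    exact (hv.shiftLim_le u x).trans (hg.shiftLim_le v _)
  · refine (hg.shiftLim hp (u + v)).le_shiftLim fun x => le_iInf fun m => ?_
    refine (iInf_le _ m).trans ?_
    refine le_trans (le_of_eq ?_) (matOp_iterate_shift_le hp m (fun y => g (y + v)) u x)
    simp only [add_assoc]

theorem shiftLim_zero (hg : IsFiniteHarmonic p g) : SubMarkov.shiftLim p 0 g = g := by
  funext x
  simp only [SubMarkov.shiftLim, add_zero]
  simp_rw [matOp_iterate_eq hg.1, ciInf_const]

/-- For harmonic `g`, the function `y ↦ lim P^n g(· + y)(x₀)` is super harmonic. -/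
theorem matOp_shiftLim_le (hp : IsShiftInvariant p) (hg : IsFiniteHarmonic p g) (x₀ : M) :
    matOp p (fun y => SubMarkov.shiftLim p y g x₀) ≤ fun y => SubMarkov.shiftLim p y g x₀ := by
  intro w
  refine le_iInf fun n => ?_
  -- The sum over `y` is exchanged with `P^n`; by commutativity it then acts on `g(x + ·)`, which is
  -- super harmonic.
  calc matOp p (fun y => SubMarkov.shiftLim p y g x₀) w
      ≤ ∑' y, p w y * (matOp p)^[n] (fun x => g (x + y)) x₀ :=
        ENNReal.tsum_le_tsum fun y => mul_le_mul_right (iInf_le _ n) _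
    _ = (matOp p)^[n] (fun x => ∑' y, p w y * g (x + y)) x₀ := by
        have := matOp_iterate_tsum (p := p) n fun (y : M) (x : M) => p w y * g (x + y)
        rw [this]
        exact tsum_congr fun y =>
          (congrFun (matOp_iterate_smul n (p w y) fun x => g (x + y)) x₀).symm
    _ ≤ (matOp p)^[n] (fun x => g (x + w)) x₀ := by
        refine matOp_iterate_mono p n (fun x => ?_) x₀
        have := matOp_shift_le hp hg.1.le x w
        simp only [add_comm _ x] at this ⊢
        exact this

end IsFiniteHarmonic

end ShiftLim

end SubMarkov

/-! ### Extraction of a super harmonic function with an exponential rate -/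

namespace SubMarkov

/-- A functional that is bounded above on `K` nearly attains its supremum at a point `g` such that
it is nearly non-negative on the elements `k` of `K` with `g - k ∈ K`. -/
theorem exists_near_maximizer {X : Type*} {K : Set X} {L : X → ℝ} (hbdd : BddAbove (L '' K))
    {h : X} (hK : h ∈ K) {c : ℝ} (hc : c < L h) {ε : ℝ} (hε : 0 < ε) :
    ∃ g ∈ K, c < L g ∧ ∀ k r, r ∈ K → L g = L r + L k → -ε < L k := by
  have hne : (L '' K).Nonempty := ⟨_, h, hK, rfl⟩
  have hlt : max c (sSup (L '' K) - ε) < sSup (L '' K) :=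
    max_lt (hc.trans_le (le_csSup hbdd ⟨h, hK, rfl⟩)) (sub_lt_self _ hε)
  obtain ⟨_, ⟨g, hg, rfl⟩, hgt⟩ := exists_lt_of_lt_csSup hne hlt
  refine ⟨g, hg, (le_max_left _ _).trans_lt hgt, fun k r hr hL => ?_⟩
  have h1 := (le_max_right _ _).trans_lt hgt
  have h2 : L r ≤ sSup (L '' K) := le_csSup hbdd ⟨r, hr, rfl⟩
  linarith

section Slope

variable {M : Type} [AddCommMonoid M] [IsCancelAdd M] {p : M → M → ℝ≥0∞}

/-- Fatou's lemma along an arbitrary filter: finite partial sums pass to the limit, the entries of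
`p` being finite. -/
theorem matOp_le_of_tendsto {ι : Type*} {l : Filter ι} [l.NeBot] {f : ι → M → ℝ≥0∞}
    {φ : M → ℝ≥0∞} (hfin : ∀ x y, p x y ≠ ⊤) (hf : ∀ i, matOp p (f i) ≤ f i)
    (h : ∀ x, Tendsto (fun i => f i x) l (𝓝 (φ x))) : matOp p φ ≤ φ := by
  intro x
  rw [matOp, ENNReal.tsum_eq_iSup_sum]
  refine iSup_le fun s => ?_
  refine le_of_tendsto_of_tendsto (f := fun i => ∑ y ∈ s, p x y * f i y) ?_ (h x)
    (Eventually.of_forall fun i => (ENNReal.sum_le_tsum s).trans (hf i x))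
  exact tendsto_finsetSum s fun y _ => ENNReal.Tendsto.const_mul (h y) (Or.inr (hfin x y))

/-- If `h` is not invariant under `shiftLim`, there is a positive super harmonic function with a
non-zero exponential rate in the direction `u`. -/
theorem exists_superharmonic_of_signed (hp : IsShiftInvariant p) (hfin : ∀ x y, p x y ≠ ⊤)
    (hirr : IsUniformlyIrreducible p) {h : M → ℝ≥0∞} (hh : IsFiniteHarmonic p h) (u x₀ : M)
    (σ lam : ℝ) (hpos : 0 < σ * ((shiftLim p u h x₀).toReal - lam * (h x₀).toReal)) :
    ∃ φ : M → ℝ≥0∞, matOp p φ ≤ φ ∧ φ 0 ≠ 0 ∧ (∀ x, φ x ≠ ⊤) ∧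
      ∀ y, 0 ≤ σ * ((φ (y + u)).toReal - lam * (φ y).toReal) := by
  classical
  obtain ⟨C, hC⟩ : ∃ C : M → ℝ≥0, ∀ v, ∀ g : M → ℝ≥0∞, matOp p g ≤ g → ∀ x,
      g (x + v) ≤ C v * g x := by
    choose C hC using fun v => hirr.harnack 0 v
    refine ⟨C, fun v g hg x => ?_⟩
    simpa [add_comm x v] using hC v g hg x
  set K : Set (M → ℝ≥0∞) := {g | IsFiniteHarmonic p g ∧ g ≤ h} with hKdef
  set L : (M → ℝ≥0∞) → ℝ := fun g =>
    σ * ((shiftLim p u g x₀).toReal - lam * (g x₀).toReal) with hL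
  -- With this constant `L g ≤ B g(x₀)`, so a lower bound on `L` keeps `g(x₀)` away from `0`; the `+
  -- 1` makes `B` positive.
  set B : ℝ := |σ| * (C u + |lam|) + 1 with hB
  have hBpos : 0 < B := by positivity
  have hLle : ∀ g, IsFiniteHarmonic p g → L g ≤ B * (g x₀).toReal := by
    intro g hg
    have h1 : (shiftLim p u g x₀).toReal ≤ C u * (g x₀).toReal := by
      have h2 := (hg.shiftLim_le u x₀).trans (hC u g hg.1.le x₀)
      have h3 := ENNReal.toReal_mono (ENNReal.mul_ne_top ENNReal.coe_ne_top (hg.2 x₀)) h2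
      rwa [ENNReal.toReal_mul, ENNReal.coe_toReal] at h3
    have h0 : 0 ≤ (shiftLim p u g x₀).toReal := ENNReal.toReal_nonneg
    have h0' : 0 ≤ (g x₀).toReal := ENNReal.toReal_nonneg
    calc L g ≤ |σ * ((shiftLim p u g x₀).toReal - lam * (g x₀).toReal)| := le_abs_self _
      _ ≤ |σ| * ((shiftLim p u g x₀).toReal + |lam| * (g x₀).toReal) := by
        rw [abs_mul]
        gcongr
        refine (abs_sub _ _).trans ?_
        rw [abs_mul, abs_of_nonneg h0, abs_of_nonneg h0']
      _ ≤ |σ| * (C u * (g x₀).toReal + |lam| * (g x₀).toReal) := by gcongr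
      _ ≤ B * (g x₀).toReal := by rw [hB]; nlinarith
  have hbdd : BddAbove (L '' K) := by
    refine ⟨B * (h x₀).toReal, ?_⟩
    rintro _ ⟨g, ⟨hg, hgh⟩, rfl⟩
    refine (hLle g hg).trans ?_
    gcongr
    exacts [hh.2 x₀, hgh x₀]
  have hhalf : L h / 2 < L h := half_lt_self hpos
  have hseq : ∀ n : ℕ, ∃ g ∈ K, L h / 2 < L g ∧
      ∀ k r, r ∈ K → L g = L r + L k → -(1 / ((n : ℝ) + 1)) < L k := fun n =>
    exists_near_maximizer hbdd ⟨hh, le_rfl⟩ hhalf (by positivity)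
  choose g hgK hgL hgmax using hseq
  set U : Ultrafilter ℕ := hyperfilter ℕ with hU
  set f : ℕ → M → ℝ≥0∞ := fun n y => shiftLim p y (g n) x₀ with hf
  -- Compactness of `[0, ∞]` gives limits along the ultrafilter at all points at once.
  obtain ⟨φ, hφ⟩ : ∃ φ : M → ℝ≥0∞, ∀ x, Tendsto (fun n => f n x) U (𝓝 (φ x)) :=
    ⟨fun x => (U.map fun n => f n x).lim, fun x => Ultrafilter.le_nhds_lim _⟩
  have hfle : ∀ n y, f n y ≤ h (x₀ + y) := fun n y =>
    ((hgK n).1.shiftLim_le y x₀).trans ((hgK n).2 _)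
  have hφle : ∀ y, φ y ≤ h (x₀ + y) := fun y =>
    le_of_tendsto (hφ y) (Eventually.of_forall fun n => hfle n y)
  have hφtop : ∀ y, φ y ≠ ⊤ := fun y => ne_top_of_le_ne_top (hh.2 _) (hφle y)
  have hreal : ∀ y, Tendsto (fun n => (f n y).toReal) U (𝓝 (φ y).toReal) := fun y =>
    (ENNReal.tendsto_toReal (hφtop y)).comp (hφ y)
  refine ⟨φ, matOp_le_of_tendsto (l := (U : Filter ℕ)) hfin
    (fun n => (hgK n).1.matOp_shiftLim_le hp x₀) hφ, ?_, hφtop, fun y => ?_⟩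
  · have h1 : L h / 2 / B ≤ (φ 0).toReal := by
      refine ge_of_tendsto (hreal 0) (Eventually.of_forall fun n => ?_)
      rw [div_le_iff₀ hBpos, mul_comm]
      simp only [hf]
      rw [(hgK n).1.shiftLim_zero]
      exact (hgL n).le.trans (hLle _ (hgK n).1)
    have h2 : 0 < L h / 2 / B := by positivity
    intro h0
    rw [h0] at h1
    simp only [ENNReal.toReal_zero] at h1
    linarith
  -- By Harnack `c T_y g ≤ g`, so `g` splits inside `K` into `c T_y g` and a remainder, and
  -- near-maximality applies to this splitting.
  · set c : ℝ≥0 := (C y + 1)⁻¹ with hc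
    have hc0 : c ≠ 0 := by positivity
    have hc1 : 0 < (c : ℝ) := by positivity
    have hstep : ∀ n : ℕ, -(1 / ((n : ℝ) + 1)) / c ≤
        σ * ((f n (y + u)).toReal - lam * (f n y).toReal) := by
      intro n
      have hg := (hgK n).1
      have hTy := hg.shiftLim hp y
      have hk : IsFiniteHarmonic p ((c : ℝ≥0∞) • shiftLim p y (g n)) := hTy.smul c
      have hkg : (c : ℝ≥0∞) • shiftLim p y (g n) ≤ g n := by
        intro x
        have h1 := (hg.shiftLim_le y x).trans (hC y _ hg.1.le x)
        calc (c : ℝ≥0∞) * shiftLim p y (g n) x ≤ c * (C y * g n x) := by gcongr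
          _ = (c * C y : ℝ≥0) * g n x := by rw [← mul_assoc]; push_cast; rfl
          _ ≤ 1 * g n x := by
            gcongr
            have : c * C y ≤ 1 := by
              rw [hc, mul_comm, ← div_eq_mul_inv]
              exact div_le_one_of_le₀ (by simp) (by positivity)
            exact_mod_cast this
          _ = g n x := one_mul _
      have hr := hg.sub hk hkg
      have hsum : (g n - (c : ℝ≥0∞) • shiftLim p y (g n)) + (c : ℝ≥0∞) • shiftLim p y (g n) = g n :=
        tsub_add_cancel_of_le hkg
      have hLadd : L (g n) = L (g n - (c : ℝ≥0∞) • shiftLim p y (g n)) +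
          L ((c : ℝ≥0∞) • shiftLim p y (g n)) := by
        have e1 := hr.shiftLim_add hp hk u
        rw [hsum] at e1
        have e2 : (shiftLim p u (g n) x₀).toReal =
            (shiftLim p u (g n - (c : ℝ≥0∞) • shiftLim p y (g n)) x₀).toReal +
            (shiftLim p u ((c : ℝ≥0∞) • shiftLim p y (g n)) x₀).toReal := by
          rw [e1, Pi.add_apply,
            ENNReal.toReal_add ((hr.shiftLim hp u).2 x₀) ((hk.shiftLim hp u).2 x₀)]
        have e3 : (g n x₀).toReal = ((g n - (c : ℝ≥0∞) • shiftLim p y (g n)) x₀).toReal +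
            (((c : ℝ≥0∞) • shiftLim p y (g n)) x₀).toReal := by
          rw [← ENNReal.toReal_add (hr.2 x₀) (hk.2 x₀), ← Pi.add_apply, hsum]
        simp only [hL]
        rw [e2, e3]
        ring
      have hlow := hgmax n _ _ ⟨hr, fun x => tsub_le_self.trans ((hgK n).2 x)⟩ hLadd
      have hLk : L ((c : ℝ≥0∞) • shiftLim p y (g n)) =
          c * (σ * ((f n (y + u)).toReal - lam * (f n y).toReal)) := by
        simp only [hL, hf]
        rw [IsFiniteHarmonic.shiftLim_smul, hg.shiftLim_shiftLim hp, add_comm u y]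
        simp only [Pi.smul_apply, smul_eq_mul, ENNReal.toReal_mul, ENNReal.coe_toReal]
        ring
      rw [hLk] at hlow
      rw [div_le_iff₀ hc1, mul_comm]
      exact hlow.le
    have hlim0 : Tendsto (fun n : ℕ => -(1 / ((n : ℝ) + 1)) / c) U (𝓝 0) := by
      have h1 : Tendsto (fun n : ℕ => -(1 / ((n : ℝ) + 1)) / c) atTop (𝓝 (-0 / c)) :=
        (tendsto_one_div_add_atTop_nhds_zero_nat.neg).div_const _
      rw [neg_zero, zero_div] at h1
      exact h1.mono_left (Nat.hyperfilter_le_atTop)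
    exact le_of_tendsto_of_tendsto hlim0
      (((hreal (y + u)).sub ((hreal y).const_mul lam)).const_mul σ)
      (Eventually.of_forall hstep)

end Slope

end SubMarkov

namespace SubMarkov

/-! ### Logarithms of positive super harmonic functions -/

section LogSuper

variable {M : Type} [AddCommMonoid M] [IsCancelAdd M] {p : M → M → ℝ≥0∞}

/-- `exp G` is super harmonic. -/
def IsLogSuperharmonic (p : M → M → ℝ≥0∞) (G : M → ℝ) : Prop :=
  ∀ x, ∑' y, p x y * ENNReal.ofReal (Real.exp (G y - G x)) ≤ 1

theorem IsLogSuperharmonic.matOp_le {G : M → ℝ} (hG : IsLogSuperharmonic p G) :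
    matOp p (fun y => ENNReal.ofReal (Real.exp (G y))) ≤ fun y => ENNReal.ofReal (Real.exp (G y)) := by
  intro x
  have h : ∀ y, p x y * ENNReal.ofReal (Real.exp (G y)) =
      p x y * ENNReal.ofReal (Real.exp (G y - G x)) * ENNReal.ofReal (Real.exp (G x)) := by
    intro y
    rw [mul_assoc, ← ENNReal.ofReal_mul (Real.exp_pos _).le, ← Real.exp_add, sub_add_cancel]
  simp only [matOp, h]
  rw [ENNReal.tsum_mul_right]
  exact mul_le_of_le_one_left' (hG x)

theorem isLogSuperharmonic_log {φ : M → ℝ≥0∞} (hφ : matOp p φ ≤ φ) (h0 : ∀ x, φ x ≠ 0)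
    (htop : ∀ x, φ x ≠ ⊤) : IsLogSuperharmonic p fun x => Real.log (φ x).toReal := by
  intro x
  have hpos : ∀ y, 0 < (φ y).toReal := fun y => ENNReal.toReal_pos (h0 y) (htop y)
  have h : ∀ y, p x y * ENNReal.ofReal
      (Real.exp (Real.log (φ y).toReal - Real.log (φ x).toReal)) = p x y * φ y * (φ x)⁻¹ := by
    intro y
    rw [Real.exp_sub, Real.exp_log (hpos y), Real.exp_log (hpos x),
      ENNReal.ofReal_div_of_pos (hpos x), ENNReal.ofReal_toReal (htop y),
      ENNReal.ofReal_toReal (htop x), mul_assoc, div_eq_mul_inv]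
  simp only [h]
  rw [ENNReal.tsum_mul_right, ← div_eq_mul_inv]
  exact ENNReal.div_le_of_le_mul (by simpa [matOp] using hφ x)

/-- Restricting the sum at `x + v` to `M + v` loses mass; the constant `c` drops out of the
increments. -/
theorem IsLogSuperharmonic.translate (hp : IsShiftInvariant p) {G : M → ℝ}
    (hG : IsLogSuperharmonic p G) (v : M) (c : ℝ) :
    IsLogSuperharmonic p fun x => G (x + v) - c := by
  intro x
  refine le_trans (le_of_eq ?_) ((matOp_apply_add hp
    (fun y => ENNReal.ofReal (Real.exp (G y - G (x + v)))) x v).ge.trans (hG (x + v)) |>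
      le_trans le_self_add)
  exact tsum_congr fun y => by rw [sub_sub_sub_cancel_right]

/-- Geometric means of super harmonic functions are super harmonic, by convexity of `exp`. -/
theorem IsLogSuperharmonic.average {G : ℕ → M → ℝ} (hG : ∀ j, IsLogSuperharmonic p (G j)) (N : ℕ) :
    IsLogSuperharmonic p fun x => (∑ j ∈ Finset.range (N + 1), G j x) / (N + 1) := by
  intro x
  have hN : (0 : ℝ) < (N : ℝ) + 1 := by positivity
  set w : ℝ := ((N : ℝ) + 1)⁻¹ with hw
  have hw0 : 0 ≤ w := by positivity
  have hwsum : ∑ _j ∈ Finset.range (N + 1), w = 1 := by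
    rw [Finset.sum_const, Finset.card_range, nsmul_eq_mul, hw]
    push_cast
    exact mul_inv_cancel₀ hN.ne'
  have hconv : ∀ y, ENNReal.ofReal (Real.exp ((∑ j ∈ Finset.range (N + 1), G j y) / (N + 1) -
      (∑ j ∈ Finset.range (N + 1), G j x) / (N + 1))) ≤
      ∑ j ∈ Finset.range (N + 1), ENNReal.ofReal w *
        ENNReal.ofReal (Real.exp (G j y - G j x)) := by
    intro y
    have h1 := convexOn_exp.map_sum_le (t := Finset.range (N + 1)) (w := fun _ => w)
      (p := fun j => G j y - G j x) (fun _ _ => hw0) hwsum (fun _ _ => Set.mem_univ _)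
    simp only [smul_eq_mul] at h1
    have h2 : ∑ j ∈ Finset.range (N + 1), w * (G j y - G j x) =
        (∑ j ∈ Finset.range (N + 1), G j y) / (N + 1) -
          (∑ j ∈ Finset.range (N + 1), G j x) / (N + 1) := by
      rw [← Finset.mul_sum, Finset.sum_sub_distrib, hw]
      ring
    rw [h2] at h1
    refine (ENNReal.ofReal_le_ofReal h1).trans (le_of_eq ?_)
    rw [ENNReal.ofReal_sum_of_nonneg fun j _ => mul_nonneg hw0 (Real.exp_pos _).le]
    exact Finset.sum_congr rfl fun j _ => ENNReal.ofReal_mul hw0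
  calc _ ≤ ∑' y, ∑ j ∈ Finset.range (N + 1), ENNReal.ofReal w *
        (p x y * ENNReal.ofReal (Real.exp (G j y - G j x))) := by
        refine ENNReal.tsum_le_tsum fun y => (mul_le_mul_right (hconv y) _).trans (le_of_eq ?_)
        rw [Finset.mul_sum]
        exact Finset.sum_congr rfl fun j _ => mul_left_comm _ _ _
    _ = ∑ j ∈ Finset.range (N + 1), ENNReal.ofReal w *
        ∑' y, p x y * ENNReal.ofReal (Real.exp (G j y - G j x)) := by
        rw [Summable.tsum_finsetSum fun _ _ => ENNReal.summable]
        exact Finset.sum_congr rfl fun j _ => ENNReal.tsum_mul_left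
    _ ≤ ∑ j ∈ Finset.range (N + 1), ENNReal.ofReal w * 1 := by
        gcongr with j
        exact hG j x
    _ = 1 := by
        simp only [mul_one]
        rw [← ENNReal.ofReal_sum_of_nonneg fun _ _ => hw0, hwsum, ENNReal.ofReal_one]

theorem isLogSuperharmonic_of_tendsto {ι : Type*} {l : Filter ι} [l.NeBot]
    (hfin : ∀ x y, p x y ≠ ⊤) {F : ι → M → ℝ} {G : M → ℝ} (hF : ∀ i, IsLogSuperharmonic p (F i))
    (h : ∀ x, Tendsto (fun i => F i x) l (𝓝 (G x))) : IsLogSuperharmonic p G := by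
  intro x
  rw [ENNReal.tsum_eq_iSup_sum]
  refine iSup_le fun s => ?_
  refine le_of_tendsto (x := l) (f := fun i => ∑ y ∈ s, p x y * ENNReal.ofReal (Real.exp (F i y - F i x))) ?_
    (Eventually.of_forall fun i => (ENNReal.sum_le_tsum s).trans (hF i x))
  refine tendsto_finsetSum s fun y _ => ENNReal.Tendsto.const_mul ?_ (Or.inr (hfin x y))
  exact ENNReal.tendsto_ofReal
    ((Real.continuous_exp.tendsto _).comp ((h y).sub (h x)))

/-- Harnack in logarithmic form: increments by `x` are bounded uniformly over all `G` and all base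
points. This is the compactness behind the averaging. -/
theorem IsUniformlyIrreducible.abs_sub_le (hirr : IsUniformlyIrreducible p) (x : M) :
    ∃ D : ℝ, ∀ G : M → ℝ, IsLogSuperharmonic p G → ∀ v, |G (x + v) - G v| ≤ D := by
  have key : ∀ a b : M, ∃ D : ℝ, ∀ G : M → ℝ, IsLogSuperharmonic p G → ∀ v,
      G (b + v) - G (a + v) ≤ D := by
    intro a b
    obtain ⟨C, hC⟩ := hirr.harnack a b
    refine ⟨Real.log (C + 1), fun G hG v => ?_⟩
    have h1 := hC _ hG.matOp_le v
    rw [show (C : ℝ≥0∞) = ENNReal.ofReal (C : ℝ) by simp,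
      ← ENNReal.ofReal_mul C.coe_nonneg, ENNReal.ofReal_le_ofReal_iff (by positivity)] at h1
    have h2 : Real.exp (G (b + v)) ≤ Real.exp (Real.log (C + 1) + G (a + v)) := by
      rw [Real.exp_add, Real.exp_log (by positivity)]
      exact h1.trans (by gcongr; simp)
    linarith [Real.exp_le_exp.1 h2]
  obtain ⟨D1, h1⟩ := key 0 x
  obtain ⟨D2, h2⟩ := key x 0
  refine ⟨max D1 D2, fun G hG v => abs_le.2 ⟨?_, ?_⟩⟩
  · have := h2 G hG v
    rw [zero_add] at this
    linarith [le_max_right D1 D2]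
  · have := h1 G hG v
    rw [zero_add] at this
    linarith [le_max_left D1 D2]

/-- `G` has a constant increment `c` along `v`. -/
def HasIncrement (G : M → ℝ) (v : M) (c : ℝ) : Prop := ∀ x, G (x + v) = G x + c

/-- `G'` is a limit of Cesàro means of the normalized translates of `G` by `j • v`. Bounds on the
increments along `u`, and increments already constant, survive both averaging and the limit. -/
theorem exists_hasIncrement_step (hp : IsShiftInvariant p) (hfin : ∀ x y, p x y ≠ ⊤)
    (hirr : IsUniformlyIrreducible p) {u : M} {σ s : ℝ} {G : M → ℝ}
    (hG : IsLogSuperharmonic p G) (hs : ∀ y, s ≤ σ * (G (y + u) - G y)) (v : M) :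
    ∃ G' : M → ℝ, IsLogSuperharmonic p G' ∧ (∀ y, s ≤ σ * (G' (y + u) - G' y)) ∧
      (∃ c, HasIncrement G' v c) ∧ ∀ w c, HasIncrement G w c → HasIncrement G' w c := by
  choose D hD using hirr.abs_sub_le
  set T : ℕ → M → ℝ := fun j x => G (x + j • v) - G (j • v) with hT
  set A : ℕ → M → ℝ := fun N x => (∑ j ∈ Finset.range (N + 1), T j x) / (N + 1) with hA
  have hAlog : ∀ N, IsLogSuperharmonic p (A N) := fun N =>
    IsLogSuperharmonic.average (fun j => hG.translate hp (j • v) _) N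
  have hdiff : ∀ N x y, A N x - A N y =
      (∑ j ∈ Finset.range (N + 1), (G (x + j • v) - G (y + j • v))) / (N + 1) := by
    intro N x y
    simp only [hA, hT]
    rw [← sub_div, ← Finset.sum_sub_distrib]
    congr 1
    exact Finset.sum_congr rfl fun j _ => by ring
  have hAbd : ∀ N x, A N x ∈ Set.Icc (-D x) (D x) := by
    intro N x
    have hN : (0 : ℝ) < (N : ℝ) + 1 := by positivity
    rw [Set.mem_Icc, ← abs_le]
    simp only [hA, hT]
    rw [abs_div, abs_of_pos hN, div_le_iff₀ hN]
    refine (Finset.abs_sum_le_sum_abs _ _).trans ?_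
    refine (Finset.sum_le_card_nsmul _ _ (D x) fun j _ => hD x G hG _).trans ?_
    rw [Finset.card_range, nsmul_eq_mul, mul_comm]
    push_cast
    rfl
  set U : Ultrafilter ℕ := hyperfilter ℕ with hU
  have hlim : ∀ x, ∃ a, Tendsto (fun N => A N x) U (𝓝 a) := by
    intro x
    obtain ⟨a, -, ha⟩ := (isCompact_Icc (a := -D x) (b := D x)).ultrafilter_le_nhds
      (U.map fun N => A N x) (by
        rw [Ultrafilter.coe_map, le_principal_iff, Filter.mem_map]
        exact Eventually.of_forall fun N => hAbd N x)
    exact ⟨a, ha⟩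
  choose G' hG' using hlim
  refine ⟨G', isLogSuperharmonic_of_tendsto (l := (U : Filter ℕ)) hfin hAlog hG', fun y => ?_,
    ⟨G' v - G' 0, fun x => ?_⟩, fun w c hw x => ?_⟩
  · refine ge_of_tendsto (((hG' (y + u)).sub (hG' y)).const_mul σ) (Eventually.of_forall fun N => ?_)
    have hN : (0 : ℝ) < (N : ℝ) + 1 := by positivity
    rw [hdiff, ← mul_div_assoc, le_div_iff₀ hN, Finset.mul_sum]
    calc s * ((N : ℝ) + 1) = ∑ _j ∈ Finset.range (N + 1), s := by
          rw [Finset.sum_const, Finset.card_range, nsmul_eq_mul, mul_comm]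
          push_cast
          rfl
      _ ≤ _ := Finset.sum_le_sum fun j _ => by
          have := hs (y + j • v)
          rwa [add_right_comm] at this
  -- The sum telescopes. Changing the base point from `x` to `0` alters the quotient by at most `2 D
  -- x / (N + 1)`, so the limiting increment does not depend on `x`.
  · have h1 : ∀ N x, A N (x + v) - A N x = (G (x + (N + 1) • v) - G x) / (N + 1) := by
      intro N x
      rw [hdiff]
      congr 1
      have h2 := Finset.sum_range_sub (fun j => G (x + j • v)) (N + 1)
      simp only [zero_smul, add_zero] at h2
      rw [← h2]
      exact Finset.sum_congr rfl fun j _ => by rw [succ_nsmul', add_assoc]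
    have h3 : ∀ N : ℕ, |(A N (x + v) - A N x) - (A N v - A N 0)| ≤ (2 * D x) * (1 / ((N : ℝ) + 1)) := by
      intro N
      have hN : (0 : ℝ) < (N : ℝ) + 1 := by positivity
      have e := h1 N 0
      rw [zero_add, zero_add] at e
      rw [h1, e, ← sub_div, abs_div, abs_of_pos hN, mul_one_div]
      gcongr
      have a1 := hD x G hG ((N + 1) • v)
      have a2 := hD x G hG 0
      rw [add_zero] at a2
      rw [abs_le] at a1 a2 ⊢
      constructor <;> linarith [a1.1, a1.2, a2.1, a2.2]
    have h4 : Tendsto (fun N => (A N (x + v) - A N x) - (A N v - A N 0)) U (𝓝 0) := by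
      refine squeeze_zero_norm h3 ?_
      have := (tendsto_one_div_add_atTop_nhds_zero_nat (𝕜 := ℝ)).const_mul (2 * D x)
      rw [mul_zero] at this
      exact this.mono_left Nat.hyperfilter_le_atTop
    have h5 := tendsto_nhds_unique h4
      (((hG' (x + v)).sub (hG' x)).sub ((hG' v).sub (hG' 0)))
    linarith
  · have h1 : ∀ N, A N (x + w) - A N x = c := by
      intro N
      have hN : (0 : ℝ) < (N : ℝ) + 1 := by positivity
      rw [hdiff, div_eq_iff hN.ne']
      have : ∀ j ∈ Finset.range (N + 1), G (x + w + j • v) - G (x + j • v) = c := fun j _ => by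
        rw [add_right_comm, hw]; ring
      rw [Finset.sum_congr rfl this, Finset.sum_const, Finset.card_range, nsmul_eq_mul, mul_comm]
      push_cast
      rfl
    have h2 := tendsto_nhds_unique (tendsto_const_nhds.congr fun N => (h1 N).symm)
      ((hG' (x + w)).sub (hG' x))
    linarith

theorem exists_hasIncrement (hp : IsShiftInvariant p) (hfin : ∀ x y, p x y ≠ ⊤)
    (hirr : IsUniformlyIrreducible p) {u : M} {σ s : ℝ} {G : M → ℝ}
    (hG : IsLogSuperharmonic p G) (hs : ∀ y, s ≤ σ * (G (y + u) - G y)) (S : Finset M) :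
    ∃ G' : M → ℝ, IsLogSuperharmonic p G' ∧ (∀ y, s ≤ σ * (G' (y + u) - G' y)) ∧
      ∀ v ∈ S, ∃ c, HasIncrement G' v c := by
  classical
  induction S using Finset.induction_on with
  | empty => exact ⟨G, hG, hs, by simp⟩
  | insert v S _ ih =>
    obtain ⟨G1, h1, h2, h3⟩ := ih
    obtain ⟨G2, k1, k2, k3, k4⟩ := exists_hasIncrement_step hp hfin hirr h1 h2 v
    refine ⟨G2, k1, k2, fun w hw => ?_⟩
    rcases Finset.mem_insert.1 hw with rfl | hw
    · exact k3
    · obtain ⟨c, hc⟩ := h3 w hw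
      exact ⟨c, k4 w c hc⟩

theorem HasIncrement.add {G : M → ℝ} {v w : M} {a b : ℝ} (hv : HasIncrement G v a)
    (hw : HasIncrement G w b) : HasIncrement G (v + w) (a + b) := fun x => by
  rw [← add_assoc, hw, hv, add_assoc]

theorem HasIncrement.nsmul {G : M → ℝ} {v : M} {a : ℝ} (hv : HasIncrement G v a) (n : ℕ) :
    HasIncrement G (n • v) (n * a) := by
  induction n with
  | zero => intro x; simp
  | succ n ih =>
    rw [succ_nsmul, Nat.cast_succ, add_one_mul]
    exact ih.add hv

theorem HasIncrement.sum {ι : Type*} {G : M → ℝ} {v : ι → M} {a : ι → ℝ} (s : Finset ι)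
    (h : ∀ i, HasIncrement G (v i) (a i)) : HasIncrement G (∑ i ∈ s, v i) (∑ i ∈ s, a i) := by
  classical
  induction s using Finset.induction_on with
  | empty => intro x; simp
  | insert i s hi ih =>
    rw [Finset.sum_insert hi, Finset.sum_insert hi]
    exact (h i).add ih

end LogSuper

end SubMarkov

namespace KilledWalk

open SubMarkov

/-! ### The lattice points of an open cone -/

section Lattice

variable {d : ℕ}

theorem toReal_add (x y : Fin d → ℤ) : toReal (x + y) = toReal x + toReal y := by
  ext i; simp [toReal]

theorem toReal_nsmul (n : ℕ) (x : Fin d → ℤ) : toReal (n • x) = (n : ℝ) • toReal x := by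
  ext i; simp [toReal]

/-- Large multiples of a point of the cone are rounded down coordinatewise and scaled back; openness
does the rest. -/
theorem exists_toReal_mem {C : ConvexCone ℝ (EuclideanSpace ℝ (Fin d))}
    (hC : (C : Set (EuclideanSpace ℝ (Fin d))).Nonempty)
    (hCopen : IsOpen (C : Set (EuclideanSpace ℝ (Fin d)))) :
    ∃ v : Fin d → ℤ, toReal v ∈ C := by
  obtain ⟨w, hw⟩ := hC
  have hcoord : ∀ i, Tendsto (fun n : ℕ => ((n : ℝ) + 1)⁻¹ * (⌊((n : ℝ) + 1) * w i⌋ : ℝ)) atTop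
      (𝓝 (w i)) := by
    intro i
    refine tendsto_of_tendsto_of_tendsto_of_le_of_le (g := fun n : ℕ => w i - 1 / ((n : ℝ) + 1))
      (h := fun _ => w i) ?_ tendsto_const_nhds ?_ ?_
    · simpa using (tendsto_const_nhds (x := w i)).sub (tendsto_one_div_add_atTop_nhds_zero_nat (𝕜 := ℝ))
    · intro n
      have hn : (0 : ℝ) < (n : ℝ) + 1 := by positivity
      simp only
      rw [inv_mul_eq_div, le_div_iff₀ hn, sub_mul, one_div, inv_mul_cancel₀ hn.ne', mul_comm (w i)]
      linarith [Int.lt_floor_add_one (((n : ℝ) + 1) * w i)]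
    · intro n
      have hn : (0 : ℝ) < (n : ℝ) + 1 := by positivity
      simp only
      rw [inv_mul_eq_div, div_le_iff₀ hn, mul_comm (w i)]
      exact Int.floor_le _
  have hlim : Tendsto (fun n : ℕ => ((n : ℝ) + 1)⁻¹ • toReal (fun i => ⌊((n : ℝ) + 1) * w i⌋)) atTop
      (𝓝 w) := by
    have h1 := ((PiLp.continuous_toLp 2 (fun _ : Fin d => ℝ)).tendsto
      (fun i => w i)).comp (tendsto_pi_nhds.2 hcoord)
    exact h1
  obtain ⟨n, hn⟩ := (hlim.eventually (hCopen.mem_nhds hw)).exists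
  refine ⟨fun i => ⌊((n : ℝ) + 1) * w i⌋, ?_⟩
  have hpos : (0 : ℝ) < (n : ℝ) + 1 := by positivity
  have := C.smul_mem hpos hn
  rwa [smul_inv_smul₀ hpos.ne'] at this

/-- A lattice point `v` of the cone, such that the multiples of `v` lie arbitrarily deep in the cone
and the neighbours of `v` lie in the cone. -/
theorem exists_deep_point {C : ConvexCone ℝ (EuclideanSpace ℝ (Fin d))}
    (hC : (C : Set (EuclideanSpace ℝ (Fin d))).Nonempty)
    (hCopen : IsOpen (C : Set (EuclideanSpace ℝ (Fin d)))) :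
    ∃ v : coneLattice C hC,
      (∀ z : Fin d → ℤ, ∀ᶠ n : ℕ in atTop, n • (v : Fin d → ℤ) + z ∈ coneLattice C hC) ∧
      ∀ i, (v : Fin d → ℤ) + Pi.single i 1 ∈ coneLattice C hC := by
  obtain ⟨v, hv⟩ := exists_toReal_mem hC hCopen
  have hdeep : ∀ z : Fin d → ℤ, ∀ᶠ n : ℕ in atTop, n • v + z ∈ coneLattice C hC := by
    intro z
    have h1 : Tendsto (fun n : ℕ => toReal v + (1 / (n : ℝ)) • toReal z) atTop (𝓝 (toReal v)) := by
      simpa using (tendsto_const_nhds (x := toReal v)).add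
        ((tendsto_one_div_atTop_nhds_zero_nat (𝕜 := ℝ)).smul_const (toReal z))
    filter_upwards [h1.eventually (hCopen.mem_nhds hv), eventually_gt_atTop 0] with n hn hpos
    have hpos' : (0 : ℝ) < n := Nat.cast_pos.2 hpos
    have h2 := C.smul_mem hpos' hn
    rw [smul_add, smul_smul, mul_one_div_cancel hpos'.ne', one_smul, ← toReal_nsmul,
      ← toReal_add] at h2
    exact subset_closure h2
  -- A large multiple of `v` is deep enough to have its neighbours in the cone; `n > 0` keeps its
  -- own multiples going to infinity.
  obtain ⟨n, hn, hpos⟩ := ((eventually_all.2 fun i : Fin d =>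
    hdeep (Pi.single i 1)).and (eventually_gt_atTop 0)).exists
  have hmem : n • v ∈ coneLattice C hC :=
    AddSubmonoid.nsmul_mem _ (show toReal v ∈ closure _ from subset_closure hv) n
  refine ⟨⟨n • v, hmem⟩, fun z => ?_, hn⟩
  have h3 : Tendsto (fun k : ℕ => k * n) atTop atTop :=
    tendsto_id.atTop_mul_const' hpos
  refine (h3.eventually (hdeep z)).mono fun k hk => ?_
  simpa only [mul_smul] using hk

end Lattice

/-! ### Irreducibility of the walk, affine functions and exponentials on the lattice -/

section Walk

variable {d : ℕ} {μ : PMF (Fin d → ℤ)} {E : AddSubmonoid (Fin d → ℤ)}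

theorem stepProb_ne_top (x y : E) : stepProb μ E x y ≠ ⊤ := μ.apply_ne_top _

/-- A path from `a` to `b` translated by `x ∈ E` stays in the semigroup `E` and keeps its
probability; `δ` is the product of its jump probabilities. -/
theorem Communication.isUniformlyIrreducible (h : Communication μ E) :
    IsUniformlyIrreducible (stepProb μ E) := by
  obtain ⟨κ, E₀, -, hpos, hpath⟩ := h
  intro a b
  rcases eq_or_ne a b with rfl | hne
  · exact ⟨0, 1, one_ne_zero, ENNReal.one_ne_top, fun φ x => by simp⟩
  obtain ⟨n, s, rfl, rfl, -, hs⟩ := hpath a b hne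
  refine ⟨n, ?_⟩
  have key : ∀ j ≤ n, ∃ δ : ℝ≥0∞, δ ≠ 0 ∧ δ ≠ ⊤ ∧ ∀ (φ : E → ℝ≥0∞) (x : E),
      δ * φ (s j + x) ≤ (matOp (stepProb μ E))^[j] φ (s 0 + x) := by
    intro j
    induction j with
    | zero => exact fun _ => ⟨1, one_ne_zero, ENNReal.one_ne_top, fun φ x => by simp⟩
    | succ j ih =>
      intro hj
      obtain ⟨δ, h0, htop, h1⟩ := ih (by omega)
      refine ⟨δ * stepProb μ E (s j) (s (j + 1)),
        mul_ne_zero h0 (hpos _ (hs j (by omega))).ne',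
        ENNReal.mul_ne_top htop (stepProb_ne_top _ _), fun φ x => ?_⟩
      rw [Function.iterate_succ_apply]
      refine le_trans ?_ (h1 _ x)
      rw [mul_assoc]
      gcongr
      rw [← stepProb_isShiftInvariant (s j) (s (j + 1)) x]
      exact ENNReal.le_tsum (f := fun y => stepProb μ E (s j + x) y * φ y) (s (j + 1) + x)
  exact key n le_rfl

/-- A function with constant increments along `v` and `v + e_i` is affine. -/
theorem sub_eq_sum_of_hasIncrement {G : E → ℝ} {v : E} {w : Fin d → E}
    (hw : ∀ i, (w i : Fin d → ℤ) = (v : Fin d → ℤ) + Pi.single i 1) {a : ℝ} {b : Fin d → ℝ}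
    (hv : HasIncrement G v a) (hb : ∀ i, HasIncrement G (w i) (b i)) (x y : E) :
    G y - G x = ∑ i, (((y : Fin d → ℤ) i - (x : Fin d → ℤ) i : ℤ) : ℝ) * (b i - a) := by
  set z : Fin d → ℤ := (y : Fin d → ℤ) - x with hz
  -- The displacement is `z = ∑ z_i (w_i - v)`. As `E` is only a semigroup, the negative terms are
  -- moved to the other side: `y + ∑ (z_i⁺ v + z_i⁻ w_i) = x + ∑ (z_i⁺ w_i + z_i⁻ v)`.
  have h1 := HasIncrement.sum Finset.univ fun i =>
    ((hb i).nsmul (z i).toNat).add (hv.nsmul (-z i).toNat)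
  have h2 := HasIncrement.sum Finset.univ fun i =>
    (hv.nsmul (z i).toNat).add ((hb i).nsmul (-z i).toNat)
  have hcast : ∀ i, ((z i).toNat : ℤ) - ((-z i).toNat : ℤ) = z i := fun i => by omega
  have heq : y + ∑ i, ((z i).toNat • v + (-z i).toNat • w i) =
      x + ∑ i, ((z i).toNat • w i + (-z i).toNat • v) := by
    have h4 : ((∑ i, ((z i).toNat • w i + (-z i).toNat • v) : E) : Fin d → ℤ) -
        (∑ i, ((z i).toNat • v + (-z i).toNat • w i) : E) = z := by
      rw [AddSubmonoid.coe_finsetSum, AddSubmonoid.coe_finsetSum, ← Finset.sum_sub_distrib]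
      refine (Finset.sum_congr rfl fun i _ => ?_).trans (Finset.univ_sum_single z)
      funext k
      have h3 : (w i : Fin d → ℤ) k = (v : Fin d → ℤ) k + Pi.single (M := fun _ => ℤ) i 1 k := by
        rw [hw i, Pi.add_apply]
      have hsm : ∀ (n : ℕ) (a : Fin d → ℤ), (n • a) k = n * a k := fun n a => by
        rw [Pi.smul_apply, nsmul_eq_mul]
      simp only [AddSubmonoid.coe_add, AddSubmonoidClass.coe_nsmul, Pi.sub_apply, Pi.add_apply,
        hsm, h3]
      rcases eq_or_ne k i with rfl | hki
      · simp only [Pi.single_eq_same]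
        linear_combination hcast k
      · simp only [Pi.single_eq_of_ne hki]
        ring
    apply Subtype.ext
    rw [AddSubmonoid.coe_add, AddSubmonoid.coe_add]
    rw [hz] at h4
    rw [← sub_eq_zero] at h4 ⊢
    rw [← neg_eq_zero, ← h4]
    abel
  have h5 := h2 y
  rw [heq, h1 x, ] at h5
  have h6 : ∀ i, (z i : ℝ) = ((z i).toNat : ℝ) - ((-z i).toNat : ℝ) := fun i => by
    exact_mod_cast (hcast i).symm
  have h7 : G y - G x = ∑ i, (((z i).toNat : ℝ) * b i + ((-z i).toNat : ℝ) * a) -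
      ∑ i, (((z i).toNat : ℝ) * a + ((-z i).toNat : ℝ) * b i) := by linarith
  rw [h7, ← Finset.sum_sub_distrib]
  refine Finset.sum_congr rfl fun i _ => ?_
  change _ = (z i : ℝ) * _
  rw [h6]
  ring

theorem jumpGen_zero : jumpGen μ 0 = 1 := by
  simp [jumpGen, μ.tsum_coe]

/-- A super harmonic exponential `exp ⟨α, ·⟩` satisfies `R(α) ≤ 1`. -/
theorem jumpGen_le_one {α : EuclideanSpace ℝ (Fin d)} {v : E}
    (hv : ∀ z : Fin d → ℤ, ∀ᶠ n : ℕ in atTop, n • (v : Fin d → ℤ) + z ∈ E) {G : E → ℝ}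
    (hG : IsLogSuperharmonic (stepProb μ E) G)
    (hGα : ∀ x y : E, G y - G x = inner ℝ α (toReal ((y : Fin d → ℤ) - x))) :
    jumpGen μ α ≤ 1 := by
  rw [jumpGen, ENNReal.tsum_eq_iSup_sum]
  refine iSup_le fun s => ?_
  -- From `n • v` with `n` large, all jumps in the finite set `s` stay in `E`.
  obtain ⟨n, hn⟩ := ((eventually_all_finset s).2 fun z _ => hv z).exists
  set x : E := n • v with hx
  set f : s → E := fun z => ⟨n • (v : Fin d → ℤ) + z, hn z z.2⟩ with hf
  have hxf : ∀ z : s, ((f z : Fin d → ℤ) - x) = z := fun z => by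
    simp [hf, hx]
  have hinj : Function.Injective f := fun z z' h => by
    apply Subtype.ext
    rw [← hxf z, ← hxf z', h]
  calc ∑ z ∈ s, μ z * ENNReal.ofReal (Real.exp (inner ℝ α (toReal z)))
      = ∑' z : s, stepProb μ E x (f z) * ENNReal.ofReal (Real.exp (G (f z) - G x)) := by
        rw [← Finset.tsum_subtype s fun z => μ z * ENNReal.ofReal (Real.exp (inner ℝ α (toReal z)))]
        refine tsum_congr fun z => ?_
        rw [hGα, stepProb, hxf]
    _ ≤ ∑' y, stepProb μ E x y * ENNReal.ofReal (Real.exp (G y - G x)) :=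
        ENNReal.tsum_comp_le_tsum_of_injective hinj
          fun y => stepProb μ E x y * ENNReal.ofReal (Real.exp (G y - G x))
    _ ≤ 1 := hG x

end Walk

end KilledWalk

namespace KilledWalk

open SubMarkov

/-! ### Invariance of harmonic functions -/

section Invariance

variable {d : ℕ} {μ : PMF (Fin d → ℤ)} {C : ConvexCone ℝ (EuclideanSpace ℝ (Fin d))}
  {hC : (C : Set (EuclideanSpace ℝ (Fin d))).Nonempty}

/-- There is no super harmonic function with a non-zero exponential rate in some direction. -/
theorem not_isLogSuperharmonic_of_slope (hCopen : IsOpen (C : Set (EuclideanSpace ℝ (Fin d))))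
    (hcomm : Communication μ (coneLattice C hC))
    (hR : ∀ α : EuclideanSpace ℝ (Fin d), α ≠ 0 → jumpGen μ 0 < jumpGen μ α)
    {G : coneLattice C hC → ℝ} (hG : IsLogSuperharmonic (stepProb μ (coneLattice C hC)) G)
    {u : coneLattice C hC} {σ s : ℝ} (hpos : 0 < s) :
    ¬ ∀ y, s ≤ σ * (G (y + u) - G y) := by
  classical
  intro hs
  obtain ⟨v, hdeep, hnear⟩ := exists_deep_point hC hCopen
  set w : Fin d → coneLattice C hC := fun i => ⟨(v : Fin d → ℤ) + Pi.single i 1, hnear i⟩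
  obtain ⟨G', hG', hs', hinc⟩ := exists_hasIncrement stepProb_isShiftInvariant stepProb_ne_top
    hcomm.isUniformlyIrreducible hG hs (insert v (Finset.univ.image w))
  obtain ⟨a, ha⟩ := hinc v (Finset.mem_insert_self _ _)
  choose b hb using fun i : Fin d =>
    hinc (w i) (Finset.mem_insert_of_mem (Finset.mem_image_of_mem w (Finset.mem_univ i)))
  have haff := sub_eq_sum_of_hasIncrement (w := w) (fun i => rfl) ha hb
  set α : EuclideanSpace ℝ (Fin d) := WithLp.toLp 2 fun i => b i - a with hα
  have hα0 : α = 0 := by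
    by_contra hne
    refine absurd (hR α hne) (not_lt.2 ?_)
    rw [jumpGen_zero]
    refine jumpGen_le_one hdeep hG' fun x y => ?_
    rw [haff x y]
    simp [PiLp.inner_apply, hα, toReal]
  have hzero : ∀ i, b i - a = 0 := fun i => by
    have := congrArg (fun z : EuclideanSpace ℝ (Fin d) => z i) hα0
    simpa [hα] using this
  have h1 := hs' 0
  rw [haff 0 (0 + u)] at h1
  simp only [hzero, mul_zero, Finset.sum_const_zero] at h1
  linarith

theorem harmonic_ne_zero {E : AddSubmonoid (Fin d → ℤ)}
    (hirr : IsUniformlyIrreducible (stepProb μ E)) {φ : E → ℝ≥0∞}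
    (hφ : matOp (stepProb μ E) φ ≤ φ) {x : E} (hx : φ x ≠ 0) (y : E) : φ y ≠ 0 := by
  obtain ⟨c, hc⟩ := hirr.harnack y x
  intro h0
  have := hc φ hφ 0
  rw [add_zero, add_zero, h0, mul_zero] at this
  exact hx (le_antisymm this bot_le)

/-- Otherwise some `λ ≠ 1` separates `T_u h(x₀)` from `h(x₀)`, and the resulting super harmonic
function has logarithmic slope beyond `log λ` along `u`, which `not_isLogSuperharmonic_of_slope`
excludes. -/
theorem shiftLim_eq_self (hCopen : IsOpen (C : Set (EuclideanSpace ℝ (Fin d))))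
    (hcomm : Communication μ (coneLattice C hC))
    (hR : ∀ α : EuclideanSpace ℝ (Fin d), α ≠ 0 → jumpGen μ 0 < jumpGen μ α)
    {h : coneLattice C hC → ℝ≥0∞} (hh : IsFiniteHarmonic (stepProb μ (coneLattice C hC)) h)
    (hpos : ∀ x, h x ≠ 0) (u : coneLattice C hC) :
    shiftLim (stepProb μ (coneLattice C hC)) u h = h := by
  have hp : IsShiftInvariant (stepProb μ (coneLattice C hC)) := stepProb_isShiftInvariant
  have hirr := hcomm.isUniformlyIrreducible
  by_contra hne
  obtain ⟨x₀, hx₀⟩ := Function.ne_iff.1 hne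
  set t := (shiftLim (stepProb μ (coneLattice C hC)) u h x₀).toReal with ht
  set b := (h x₀).toReal with hb
  have hb0 : 0 < b := ENNReal.toReal_pos (hpos x₀) (hh.2 x₀)
  have ht0 : 0 ≤ t := ENNReal.toReal_nonneg
  have htb : t ≠ b := fun h' =>
    hx₀ ((ENNReal.toReal_eq_toReal_iff' ((hh.shiftLim hp u).2 x₀) (hh.2 x₀)).1 h')
  -- The midpoint of `1` and the ratio `t / b`; `σ` records on which side of `1` the ratio lies.
  set lam := (b + t) / (2 * b) with hlam
  have hlam0 : 0 < lam := by positivity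
  have hlamb : lam * b = (b + t) / 2 := by rw [hlam]; field_simp
  obtain ⟨σ, hσ, hσlog⟩ : ∃ σ : ℝ, 0 < σ * (t - lam * b) ∧ (σ = 1 ∧ 1 < lam ∨ σ = -1 ∧ lam < 1) := by
    rcases lt_or_gt_of_ne htb with hlt | hgt
    · refine ⟨-1, by rw [hlamb]; linarith, Or.inr ⟨rfl, ?_⟩⟩
      rw [hlam, div_lt_one (by positivity)]
      linarith
    · refine ⟨1, by rw [hlamb]; linarith, Or.inl ⟨rfl, ?_⟩⟩
      rw [hlam, one_lt_div (by positivity)]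
      linarith
  obtain ⟨φ, hφ, hφ0, hφtop, hslope⟩ :=
    exists_superharmonic_of_signed hp stepProb_ne_top hirr hh u x₀ σ lam hσ
  have hφne := harmonic_ne_zero hirr hφ hφ0
  have hφpos : ∀ y, 0 < (φ y).toReal := fun y => ENNReal.toReal_pos (hφne y) (hφtop y)
  refine not_isLogSuperharmonic_of_slope (σ := σ) (s := σ * Real.log lam) (u := u) hCopen hcomm hR
    (isLogSuperharmonic_log hφ hφne hφtop) ?_ fun y => ?_
  · rcases hσlog with ⟨rfl, h1⟩ | ⟨rfl, h1⟩
    · linarith [Real.log_pos h1]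
    · linarith [Real.log_neg hlam0 h1]
  · have h2 := hslope y
    have hprod : Real.log (lam * (φ y).toReal) = Real.log lam + Real.log (φ y).toReal :=
      Real.log_mul hlam0.ne' (hφpos y).ne'
    rcases hσlog with ⟨rfl, h1⟩ | ⟨rfl, h1⟩
    · have h3 : lam * (φ y).toReal ≤ (φ (y + u)).toReal := by linarith
      have h4 := Real.log_le_log (mul_pos hlam0 (hφpos y)) h3
      linarith
    · have h3 : (φ (y + u)).toReal ≤ lam * (φ y).toReal := by linarith
      have h4 := Real.log_le_log (hφpos _) h3
      linarith

end Invariance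

/-! ### The renewal equations -/

section Renewal

variable {d : ℕ} {μ : PMF (Fin d → ℤ)} {E : AddSubmonoid (Fin d → ℤ)}

/-- Riesz decomposition: `h(· + u)` is the potential of its defect, the exit term, plus its harmonic
part `T_u h`, which is `h` by `hinv`. -/
theorem eq_add_tsum_exitOp {h : E → ℝ≥0∞} (hh : IsFiniteHarmonic (stepProb μ E) h) {u : E}
    (hinv : shiftLim (stepProb μ E) u h = h) (x : E) :
    h (x + u) = h x + ∑' t, (matOp (stepProb μ E))^[t] (exitOp (stepProb μ E) u h) x := by
  have hp : IsShiftInvariant (stepProb μ E) := stepProb_isShiftInvariant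
  have hdec : (fun y => h (y + u)) =
      exitOp (stepProb μ E) u h + matOp (stepProb μ E) fun y => h (y + u) := by
    funext y
    have := matOp_apply_add hp h y u
    rw [hh.1] at this
    exact this.trans (add_comm _ _)
  have h1 : Tendsto (fun n => ∑ t ∈ Finset.range n,
      (matOp (stepProb μ E))^[t] (exitOp (stepProb μ E) u h) x +
        (matOp (stepProb μ E))^[n] (fun y => h (y + u)) x) atTop
      (𝓝 (∑' t, (matOp (stepProb μ E))^[t] (exitOp (stepProb μ E) u h) x + h x)) := by
    refine (ENNReal.tendsto_nat_tsum _).add ?_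
    have h0 : Tendsto (fun n => (matOp (stepProb μ E))^[n] (fun y => h (y + u)) x) atTop
        (𝓝 (shiftLim (stepProb μ E) u h x)) :=
      tendsto_atTop_iInf fun m n hmn => hh.shift_antitone hp u hmn x
    rwa [hinv] at h0
  have h2 : ∀ n, h (x + u) = ∑ t ∈ Finset.range n,
      (matOp (stepProb μ E))^[t] (exitOp (stepProb μ E) u h) x +
        (matOp (stepProb μ E))^[n] (fun y => h (y + u)) x := fun n =>
    eq_sum_add_matOp_iterate hdec n x
  exact (tendsto_nhds_unique (tendsto_const_nhds.congr h2) h1).trans (add_comm _ _)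

/-- The truncated mean killing time `𝔼_x(τ ∧ n)`. -/
noncomputable def truncTime (μ : PMF (Fin d → ℤ)) (E : AddSubmonoid (Fin d → ℤ)) (n : ℕ) (x : E) :
    ℝ≥0∞ := ∑ t ∈ Finset.range n, (matOp (stepProb μ E))^[t] 1 x

theorem truncTime_succ (n : ℕ) :
    truncTime μ E (n + 1) = 1 + matOp (stepProb μ E) (truncTime μ E n) :=
  funext fun x => sum_range_succ_matOp n 1 x

theorem truncTime_mono {m n : ℕ} (hmn : m ≤ n) : truncTime μ E m ≤ truncTime μ E n := fun _ =>
  Finset.sum_le_sum_of_subset (Finset.range_subset_range.2 hmn)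

theorem matOp_iterate_one_le (n : ℕ) : (matOp (stepProb μ E))^[n] 1 ≤ 1 :=
  matOp_iterate_le_of_le (matOp_one_le (stepProb_substochastic μ E)) n

theorem truncTime_le (n : ℕ) (x : E) : truncTime μ E n x ≤ n := by
  refine (Finset.sum_le_card_nsmul _ _ 1 fun t _ => matOp_iterate_one_le t x).trans ?_
  simp

theorem truncTime_add (m n : ℕ) :
    truncTime μ E (m + n) = truncTime μ E m + (matOp (stepProb μ E))^[m] (truncTime μ E n) := by
  induction m with
  | zero => simp only [Function.iterate_zero, id, zero_add]; funext x; simp [truncTime]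
  | succ m ih =>
    rw [show m + 1 + n = m + n + 1 by omega, truncTime_succ, ih, matOp_add, truncTime_succ,
      Function.iterate_succ_apply', add_assoc]

/-- Inside `E + u` the walk from `x + u` copies the walk from `x`; after the exit, the remaining
truncated lifetime is bounded by the one with the full horizon `n`. -/
theorem truncTime_shift_le (n : ℕ) (x u : E) :
    truncTime μ E n (x + u) ≤ truncTime μ E n x + ∑ t ∈ Finset.range n,
      (matOp (stepProb μ E))^[t] (exitOp (stepProb μ E) u (truncTime μ E n)) x := by
  have hp : IsShiftInvariant (stepProb μ E) := stepProb_isShiftInvariant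
  induction n generalizing x with
  | zero => simp [truncTime]
  | succ n ih =>
    have hmono : truncTime μ E n ≤ truncTime μ E (n + 1) := truncTime_mono (Nat.le_succ n)
    have hP : matOp (stepProb μ E) (fun y => truncTime μ E n (y + u)) x ≤
        matOp (stepProb μ E) (truncTime μ E n) x +
          matOp (stepProb μ E) (fun y => ∑ t ∈ Finset.range n,
            (matOp (stepProb μ E))^[t] (exitOp (stepProb μ E) u (truncTime μ E (n + 1))) y) x := by
      rw [← Pi.add_apply, ← matOp_add]
      refine matOp_mono _ (fun y => (ih y).trans ?_) x
      simp only [Pi.add_apply]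
      gcongr with t
      exact matOp_iterate_mono _ t (exitOp_mono _ u hmono) y
    calc truncTime μ E (n + 1) (x + u)
        = 1 + (matOp (stepProb μ E) (fun y => truncTime μ E n (y + u)) x +
            exitOp (stepProb μ E) u (truncTime μ E n) x) := by
          rw [truncTime_succ, Pi.add_apply, matOp_apply_add hp, Pi.one_apply]
      _ ≤ 1 + ((matOp (stepProb μ E) (truncTime μ E n) x +
          matOp (stepProb μ E) (fun y => ∑ t ∈ Finset.range n,
            (matOp (stepProb μ E))^[t] (exitOp (stepProb μ E) u (truncTime μ E (n + 1))) y) x) +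
            exitOp (stepProb μ E) u (truncTime μ E (n + 1)) x) := by
          gcongr
          exact exitOp_mono _ u hmono x
      _ = _ := by
          rw [sum_range_succ_matOp, truncTime_succ n, Pi.add_apply, Pi.one_apply]
          ring

theorem truncTime_le_ladder (n : ℕ) :
    truncTime μ E n ≤ truncTime μ E n 0 • 1 + matOp (ladderProb μ E) (truncTime μ E n) := by
  intro u
  have h1 := truncTime_shift_le (μ := μ) n 0 u
  rw [zero_add] at h1
  rw [matOp_ladderProb]
  simp only [Pi.add_apply, Pi.smul_apply, Pi.one_apply, smul_eq_mul, mul_one]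
  refine h1.trans ?_
  gcongr
  exact ENNReal.sum_le_tsum _

/-- Iterating `truncTime_le_ladder` leaves a remainder at most `n Q^k 1`, which vanishes as `k → ∞`
because `V = ∑ Q^k 1` is finite. Truncation serves to bound this remainder. -/
theorem truncTime_le_mul_renewal (hV : ∀ x : E, renewal μ E x ≠ ⊤) (n : ℕ) (x : E) :
    truncTime μ E n x ≤ truncTime μ E n 0 * renewal μ E x := by
  have hbd : truncTime μ E n ≤ (n : ℝ≥0∞) • 1 := fun y => by
    simpa using truncTime_le n y
  have h1 : ∀ k, truncTime μ E n x ≤ truncTime μ E n 0 * renewal μ E x +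
      n * (matOp (ladderProb μ E))^[k] 1 x := by
    intro k
    refine (le_sum_add_matOp_iterate (truncTime_le_ladder n) k x).trans ?_
    rw [renewal_eq_tsum]
    gcongr
    · simp only [matOp_iterate_smul, Pi.smul_apply, smul_eq_mul]
      rw [← Finset.mul_sum]
      gcongr
      exact ENNReal.sum_le_tsum _
    · have := matOp_iterate_mono (ladderProb μ E) k hbd x
      rwa [matOp_iterate_smul] at this
  have h2 : Tendsto (fun k => (matOp (ladderProb μ E))^[k] 1 x) atTop (𝓝 0) := by
    refine ENNReal.tendsto_atTop_zero_of_tsum_ne_top ?_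
    rw [← renewal_eq_tsum]
    exact hV x
  have h3 : Tendsto (fun k => truncTime μ E n 0 * renewal μ E x +
      n * (matOp (ladderProb μ E))^[k] 1 x) atTop
      (𝓝 (truncTime μ E n 0 * renewal μ E x + n * 0)) :=
    tendsto_const_nhds.add (ENNReal.Tendsto.const_mul h2 (Or.inr (ENNReal.natCast_ne_top n)))
  rw [mul_zero, add_zero] at h3
  exact ge_of_tendsto h3 (Eventually.of_forall h1)

/-- The mean killing time `𝔼_x(τ)`. -/
noncomputable def meanTime (μ : PMF (Fin d → ℤ)) (E : AddSubmonoid (Fin d → ℤ)) (x : E) : ℝ≥0∞ :=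
  meanKillingTime (stepProb μ E) (stepProb_substochastic μ E) x

theorem meanTime_eq_tsum (x : E) :
    meanTime μ E x = ∑' t, (matOp (stepProb μ E))^[t] 1 x := meanKillingTime_eq_tsum x

theorem meanTime_eq_iSup (x : E) : meanTime μ E x = ⨆ n, truncTime μ E n x := by
  rw [meanTime_eq_tsum, ENNReal.tsum_eq_iSup_nat]
  rfl

theorem meanTime_le_mul_renewal (hV : ∀ x : E, renewal μ E x ≠ ⊤) (x : E) :
    meanTime μ E x ≤ meanTime μ E 0 * renewal μ E x := by
  rw [meanTime_eq_iSup]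
  refine iSup_le fun n => (truncTime_le_mul_renewal hV n x).trans ?_
  gcongr
  rw [meanTime_eq_iSup]
  exact le_iSup (fun n => truncTime μ E n 0) n

theorem meanTime_eq : meanTime μ E = 1 + matOp (stepProb μ E) (meanTime μ E) := by
  have h : meanTime μ E = fun x => ∑' t, (matOp (stepProb μ E))^[t] 1 x :=
    funext meanTime_eq_tsum
  rw [h, matOp_tsum]
  funext x
  rw [tsum_eq_zero_add' ENNReal.summable]
  simp only [Pi.add_apply, Function.iterate_succ_apply', Function.iterate_zero, id]

/-- The shifted mean time dominates the potential of `1` plus the exit term; at `0`, the `1`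
contributes `s(0)` and the exit term contributes `Q s`. -/
theorem ladder_le_meanTime :
    meanTime μ E 0 • 1 + matOp (ladderProb μ E) (meanTime μ E) ≤ meanTime μ E := by
  have hp : IsShiftInvariant (stepProb μ E) := stepProb_isShiftInvariant
  intro u
  have hdec : (1 + exitOp (stepProb μ E) u (meanTime μ E)) +
      matOp (stepProb μ E) (fun y => meanTime μ E (y + u)) ≤ fun y => meanTime μ E (y + u) := by
    intro y
    refine le_of_eq ?_
    have h1 : meanTime μ E (y + u) = 1 + matOp (stepProb μ E) (meanTime μ E) (y + u) :=
      congrFun meanTime_eq (y + u)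
    simp only [Pi.add_apply, Pi.one_apply]
    rw [h1, matOp_apply_add hp]
    ring
  have h2 : ∀ n, ∑ t ∈ Finset.range n,
      (matOp (stepProb μ E))^[t] (1 + exitOp (stepProb μ E) u (meanTime μ E)) 0 ≤
        meanTime μ E u := by
    intro n
    have := (le_self_add).trans (sum_matOp_iterate_le hdec n 0)
    rwa [zero_add] at this
  have h3 : ∑' t, (matOp (stepProb μ E))^[t] (1 + exitOp (stepProb μ E) u (meanTime μ E)) 0 ≤
      meanTime μ E u := by
    rw [ENNReal.tsum_eq_iSup_nat]
    exact iSup_le h2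
  simp only [matOp_iterate_add, Pi.add_apply, ENNReal.tsum_add] at h3
  rw [matOp_ladderProb]
  simp only [Pi.add_apply, Pi.smul_apply, Pi.one_apply, smul_eq_mul, mul_one]
  rwa [meanTime_eq_tsum 0]

theorem mul_renewal_le_meanTime (x : E) :
    meanTime μ E 0 * renewal μ E x ≤ meanTime μ E x := by
  rw [renewal_eq_tsum, ← ENNReal.tsum_mul_left, ENNReal.tsum_eq_iSup_nat]
  refine iSup_le fun n => le_trans ?_
    (le_self_add.trans (sum_matOp_iterate_le ladder_le_meanTime n x))
  simp only [matOp_iterate_smul, Pi.smul_apply, smul_eq_mul]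
  exact le_rfl

theorem one_le_meanTime (x : E) : 1 ≤ meanTime μ E x := by
  rw [meanTime_eq_tsum]
  exact ENNReal.le_tsum (f := fun t => (matOp (stepProb μ E))^[t] 1 x) 0

/-- If the mean killing time is infinite, a harmonic function has no part that is invariant for the
ladder process. -/
theorem eq_zero_of_meanTime_eq_top (hirr : IsUniformlyIrreducible (stepProb μ E))
    {h k : E → ℝ≥0∞} (hh : IsFiniteHarmonic (stepProb μ E) h) (hV : ∀ x : E, renewal μ E x ≠ ⊤)
    (hdec : ∀ x, h x = h 0 * renewal μ E x + k x) (htop : meanTime μ E 0 = ⊤) (x : E) :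
    k x = 0 := by
  have hle : ∀ n, h 0 • truncTime μ E n + truncTime μ E n 0 • k ≤ truncTime μ E n 0 • h := by
    intro n y
    simp only [Pi.add_apply, Pi.smul_apply, smul_eq_mul]
    rw [hdec y, mul_add, mul_left_comm (truncTime μ E n 0)]
    gcongr
    exact truncTime_le_mul_renewal hV n y
  have hstep : ∀ j n, truncTime μ E n 0 * (matOp (stepProb μ E))^[j] k 0 ≤ h 0 * j := by
    intro j n
    have h1 := matOp_iterate_mono (stepProb μ E) j (hle n) 0
    rw [matOp_iterate_add, matOp_iterate_smul, matOp_iterate_smul, matOp_iterate_smul,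
      matOp_iterate_eq hh.1] at h1
    simp only [Pi.add_apply, Pi.smul_apply, smul_eq_mul] at h1
    -- Moving the start to time `j` costs at most `j` units of truncated time, uniformly in `n`;
    -- this bounded loss cannot compensate `s_n(0) P^j k(0)` as `n → ∞`.
    have h2 : truncTime μ E n 0 ≤ j + (matOp (stepProb μ E))^[j] (truncTime μ E n) 0 := by
      refine (truncTime_mono (Nat.le_add_left n j) 0).trans ?_
      rw [truncTime_add]
      exact add_le_add_left (truncTime_le j 0) _
    have h3 : h 0 * truncTime μ E n 0 + truncTime μ E n 0 * (matOp (stepProb μ E))^[j] k 0 ≤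
        h 0 * truncTime μ E n 0 + h 0 * j := by
      calc _ ≤ h 0 * (j + (matOp (stepProb μ E))^[j] (truncTime μ E n) 0) +
            truncTime μ E n 0 * (matOp (stepProb μ E))^[j] k 0 := by gcongr
        _ = h 0 * j + (h 0 * (matOp (stepProb μ E))^[j] (truncTime μ E n) 0 +
            truncTime μ E n 0 * (matOp (stepProb μ E))^[j] k 0) := by ring
        _ ≤ h 0 * j + truncTime μ E n 0 * h 0 := by gcongr
        _ = _ := by ring
    refine (ENNReal.add_le_add_iff_left ?_).1 h3
    exact ENNReal.mul_ne_top (hh.2 0)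
      (ne_top_of_le_ne_top (ENNReal.natCast_ne_top n) (truncTime_le n 0))
  have hzero : ∀ j, (matOp (stepProb μ E))^[j] k 0 = 0 := by
    intro j
    by_contra hne
    have h1 : meanTime μ E 0 * (matOp (stepProb μ E))^[j] k 0 ≤ h 0 * j := by
      rw [meanTime_eq_iSup, ENNReal.iSup_mul]
      exact iSup_le fun n => hstep j n
    rw [htop, ENNReal.top_mul hne, top_le_iff] at h1
    exact ENNReal.mul_ne_top (hh.2 0) (ENNReal.natCast_ne_top j) h1
  -- All `P^j k(0)` vanish, and some `P^j` reaches `x` from `0`.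
  obtain ⟨j, δ, hδ, -, hj⟩ := hirr 0 x
  have h1 := hj k 0
  rw [add_zero, add_zero, hzero, nonpos_iff_eq_zero, mul_eq_zero] at h1
  exact h1.resolve_left hδ

/-- If the mean killing time is finite, a positive harmonic function is not proportional to the
renewal function. -/
theorem ne_mul_renewal_of_meanTime_ne_top {h : E → ℝ≥0∞} (hh : IsFiniteHarmonic (stepProb μ E) h)
    {z : E} (hz : meanTime μ E z ≠ ⊤) (hpos : h z ≠ 0) :
    ¬ ∀ x, h x = h 0 * renewal μ E x := by
  intro heq
  have hle : h ≤ h 0 • meanTime μ E := by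
    intro x
    rw [heq x]
    simp only [Pi.smul_apply, smul_eq_mul]
    gcongr
    exact (le_mul_of_one_le_left' (one_le_meanTime 0)).trans (mul_renewal_le_meanTime x)
  -- Applying `P^n` to `h ≤ h(0) s` bounds `h(z)` by a tail of the convergent series for `s(z)`.
  have h1 : ∀ n, h z ≤ h 0 * ∑' t, (matOp (stepProb μ E))^[t + n] 1 z := by
    intro n
    have h2 := matOp_iterate_mono (stepProb μ E) n hle z
    rw [matOp_iterate_eq hh.1, matOp_iterate_smul] at h2
    refine h2.trans (le_of_eq ?_)
    have h3 : meanTime μ E = fun x => ∑' t, (matOp (stepProb μ E))^[t] 1 x :=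
      funext meanTime_eq_tsum
    rw [Pi.smul_apply, smul_eq_mul, h3, matOp_iterate_tsum]
    congr 1
    exact tsum_congr fun t => by rw [add_comm, Function.iterate_add_apply]
  have h2 : Tendsto (fun n => h 0 * ∑' t, (matOp (stepProb μ E))^[t + n] 1 z) atTop (𝓝 (h 0 * 0)) := by
    refine ENNReal.Tendsto.const_mul ?_ (Or.inr (hh.2 0))
    refine ENNReal.tendsto_sum_nat_add (fun t => (matOp (stepProb μ E))^[t] 1 z) ?_
    rw [← meanTime_eq_tsum]
    exact hz
  rw [mul_zero] at h2
  exact hpos (le_antisymm (ge_of_tendsto h2 (Eventually.of_forall h1)) bot_le)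

end Renewal

end KilledWalk

/-! ### Assembly of the theorem -/

open SubMarkov KilledWalk

theorem mainTheorem4 (d : ℕ) (μ : PMF (Fin d → ℤ))
    (C : ConvexCone ℝ (EuclideanSpace ℝ (Fin d)))
    (hC : (C : Set (EuclideanSpace ℝ (Fin d))).Nonempty)
    (hCopen : IsOpen (C : Set (EuclideanSpace ℝ (Fin d))))
    (E : AddSubmonoid (Fin d → ℤ)) (hE : E = KilledWalk.coneLattice C hC)
    (htrans : SubMarkov.IsTransient (KilledWalk.stepProb μ E)
      (KilledWalk.stepProb_substochastic μ E))
    (hcomm : KilledWalk.Communication μ E)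
    (hR : ∀ α : EuclideanSpace ℝ (Fin d), α ≠ 0 →
      KilledWalk.jumpGen μ 0 < KilledWalk.jumpGen μ α)
    (h : E → ℝ≥0) (hne : h ≠ 0) (hharm : SubMarkov.IsHarmonic (KilledWalk.stepProb μ E) h) :
    SubMarkov.IsSuperharmonic (KilledWalk.ladderProb μ E) h ∧
    (∀ x u : E, (h (x + u) : ℝ≥0∞) = h x +
      ∫⁻ ω, SubMarkov.valueAt h ω (KilledWalk.shiftExitTime E u ω)
        ∂(KilledWalk.walkLaw μ E (x + u))) ∧
    (∀ x : E, KilledWalk.renewal μ E x ≠ ⊤) ∧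
    ∃ h' : E → ℝ≥0,
      SubMarkov.IsHarmonic (KilledWalk.ladderProb μ E) h' ∧
      (∀ x : E, (h x : ℝ≥0∞) = h 0 * KilledWalk.renewal μ E x + h' x) ∧
      (∀ x : E, Tendsto
        (fun n : ℕ => ∫⁻ ω, SubMarkov.valueAt h ω (KilledWalk.ladderTime E ω n)
          ∂(KilledWalk.walkLaw μ E x))
        atTop (𝓝 (h' x : ℝ≥0∞))) ∧
      (∀ z : E,
        (SubMarkov.meanKillingTime (KilledWalk.stepProb μ E)
            (KilledWalk.stepProb_substochastic μ E) z = ⊤ →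
          h' = 0 ∧ ∃ c : ℝ≥0, ∀ x : E, (h x : ℝ≥0∞) = c * KilledWalk.renewal μ E x) ∧
        (SubMarkov.meanKillingTime (KilledWalk.stepProb μ E)
            (KilledWalk.stepProb_substochastic μ E) z ≠ ⊤ →
          h' ≠ 0)) := by
  subst hE
  have hh : IsFiniteHarmonic (stepProb μ (coneLattice C hC)) fun x => (h x : ℝ≥0∞) :=
    ⟨funext hharm, fun x => ENNReal.coe_ne_top⟩
  have hirr := hcomm.isUniformlyIrreducible
  have hpos : ∀ x, (h x : ℝ≥0∞) ≠ 0 := by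
    obtain ⟨x, hx⟩ := Function.ne_iff.1 hne
    exact harmonic_ne_zero hirr hh.1.le (x := x) (ENNReal.coe_ne_zero.2 hx)
  have hinv := shiftLim_eq_self hCopen hcomm hR hh hpos
  have hexit := fun x u => eq_add_tsum_exitOp hh (hinv u) x
  set L := matOp (ladderProb μ (coneLattice C hC)) with hL
  -- The exit formula started at `u = 0 + u`.
  have hladder : (fun x => (h x : ℝ≥0∞)) = (h 0 : ℝ≥0∞) • 1 + L fun x => (h x : ℝ≥0∞) := by
    funext u
    have h1 := hexit 0 u
    rw [zero_add] at h1
    rw [hL, matOp_ladderProb]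
    simpa [ladderOp] using h1
  have hsuper : L (fun x => (h x : ℝ≥0∞)) ≤ fun x => (h x : ℝ≥0∞) := by
    nth_rewrite 2 [hladder]
    exact le_add_self
  have hsum : ∀ n x, (h x : ℝ≥0∞) = h 0 * ∑ t ∈ Finset.range n, L^[t] 1 x +
      L^[n] (fun x => (h x : ℝ≥0∞)) x := by
    intro n x
    refine (eq_sum_add_matOp_iterate hladder n x).trans ?_
    simp only [matOp_iterate_smul, Pi.smul_apply, smul_eq_mul, ← Finset.mul_sum]
    rfl
  have hlim : ∀ x, Tendsto (fun n => L^[n] (fun x => (h x : ℝ≥0∞)) x) atTop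
      (𝓝 (⨅ n, L^[n] (fun x => (h x : ℝ≥0∞)) x)) := fun x =>
    tendsto_atTop_iInf fun m n hmn => matOp_iterate_antitone hsuper hmn x
  have hdec : ∀ x, (h x : ℝ≥0∞) = h 0 * renewal μ (coneLattice C hC) x +
      ⨅ n, L^[n] (fun x => (h x : ℝ≥0∞)) x := by
    intro x
    refine tendsto_nhds_unique (tendsto_const_nhds.congr fun n => hsum n x)
      (Tendsto.add (ENNReal.Tendsto.const_mul ?_ (Or.inr ENNReal.coe_ne_top)) (hlim x))
    rw [renewal_eq_tsum]
    exact ENNReal.tendsto_nat_tsum _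
  -- Finiteness comes from `h(0) V ≤ h < ∞` together with `h(0) > 0`.
  have hV : ∀ x, renewal μ (coneLattice C hC) x ≠ ⊤ := by
    intro x htop
    have h1 := hdec x
    rw [htop, ENNReal.mul_top (hpos 0), top_add] at h1
    exact ENNReal.coe_ne_top h1
  have hfin : ∀ x, ⨅ n, L^[n] (fun x => (h x : ℝ≥0∞)) x ≠ ⊤ := fun x =>
    ne_top_of_le_ne_top ENNReal.coe_ne_top (iInf_le _ 0)
  have hcoe : ∀ x, (((⨅ n, L^[n] (fun x => (h x : ℝ≥0∞)) x).toNNReal : ℝ≥0) : ℝ≥0∞) =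
      ⨅ n, L^[n] (fun x => (h x : ℝ≥0∞)) x := fun x => ENNReal.coe_toNNReal (hfin x)
  refine ⟨fun x => hsuper x, fun x u => ?_, hV,
    fun x => (⨅ n, L^[n] (fun x => (h x : ℝ≥0∞)) x).toNNReal, fun x => ?_, fun x => ?_,
    fun x => ?_, fun z => ⟨fun hz => ?_, fun hz => ?_⟩⟩
  · rw [lintegral_valueAt_shiftExitTime]
    exact hexit x u
  · simp only [transOp, hcoe]
    exact congrFun (matOp_iInf_iterate hsuper fun x => ENNReal.coe_ne_top) x
  · rw [hcoe]
    exact hdec x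
  · rw [hcoe]
    simp_rw [lintegral_valueAt_ladderTime]
    exact hlim x
  -- Infinite mean time at `z` is carried to `0` by `s(z) ≤ s(0) V(z)`.
  · have htop : meanTime μ (coneLattice C hC) 0 = ⊤ := by
      by_contra hne0
      exact ENNReal.mul_ne_top hne0 (hV z) (top_le_iff.1 (hz.ge.trans (meanTime_le_mul_renewal hV z)))
    have hzero := eq_zero_of_meanTime_eq_top hirr hh hV hdec htop
    refine ⟨funext fun x => ?_, h 0, fun x => ?_⟩
    · rw [hzero x]; rfl
    · refine (hdec x).trans ?_
      rw [hzero x, add_zero]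
  · intro h0
    refine ne_mul_renewal_of_meanTime_ne_top hh hz (hpos z) fun x => (hdec x).trans ?_
    have := congrFun h0 x
    rw [← hcoe, this]
    simp
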